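/- For $m\ge 1$ let $B_m=K_2+\overline{K_m}$ be the book with $m$ pages, i.e. the graph consisting of two adjacent vertices together with $m$ pairwise non-adjacent further vertices, each adjacent to both of them. Let $R(G,H)$ be the two-color Ramsey number, i.e. the least $n$ such that every red-blue coloring of the edges of $K_n$ contains a red copy of $G$ or a blue copy of $H$, and put $$R'_m=\sum_{i=1}^{m-1}\bigl(R(B_{\lceil m/i\rceil},B_{\lceil m/i\rceil})-1\bigr).$$ A $k$-coloring of $K_n$ assigns to each edge one of $k$ given colors (not every color has to occur). A color is called $m$-inadmissible in such a coloring if every vertex is incident with fewer than $m$ edges of that color. For $0\le\ell\le k$ let $gr_{k,\ell}(K_3:B_m)$ be the minimum integer $n$ such that every $k$-coloring of $K_n$ with at least $\ell$ different $m$-inadmissible colors contains either a rainbow triangle (a triangle whose three edges have pairwise different colors) or a monochromatic copy of $B_m$. Theorem. For all integers $k\ge 1$, $m\ge 3$ and $0\le\ell\le k$, the number $gr_{k,\ell}(K_3:B_m)$ exists and $$gr_{k,\ell}(K_3:B_m)\le\begin{cases} m+2-\ell & \text{if } k=1,\\ R'_m\cdot 5^{(k-2)/2}+1-(m-1)\ell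 & \text{if } k \text{ is even},\\ 2R'_m\cdot 5^{(k-3)/2}+1-(m-1)\ell & \text{if } k\ge 3 \text{ is odd.}\end{cases}$$ -/

import Mathlib

open scoped SimpleGraph

/-- The book with `m` pages: the join of a complete graph on two vertices (the spine) with an
edgeless graph on `m` vertices (the pages). -/
def bookGraph (m : ℕ) : SimpleGraph (Fin 2 ⊕ Fin m) :=
  ((⊤ : SimpleGraph (Fin 2)) ⊕g (⊥ : SimpleGraph (Fin m))) ⊔ completeBipartiteGraph (Fin 2) (Fin m)

/-- Every red-blue coloring of the complete graph on `n` vertices contains a red copy of `G` or a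
blue copy of `H`; `true` is red and `false` is blue. -/
def RamseyProperty {V W : Type*} (G : SimpleGraph V) (H : SimpleGraph W) (n : ℕ) : Prop :=
  ∀ C : SimpleGraph.TopEdgeLabeling (Fin n) Bool, G ⊑ C.labelGraph true ∨ H ⊑ C.labelGraph false

/-- The two-color Ramsey number `R(G, H)`. For finite graphs the set below is nonempty by Ramsey's
theorem, so that the infimum is its least element. -/
noncomputable def ramseyNumber {V W : Type*} (G : SimpleGraph V) (H : SimpleGraph W) : ℕ :=
  sInf {n : ℕ | RamseyProperty G H n}

/-- `R'_m`, the sum of `R(B_⌈m/i⌉, B_⌈m/i⌉) - 1` over `1 ≤ i ≤ m - 1`. -/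
noncomputable def bookRamseySum (m : ℕ) : ℤ :=
  ∑ i ∈ Finset.Icc 1 (m - 1),
    ((ramseyNumber (bookGraph ⌈(m : ℚ) / (i : ℚ)⌉₊) (bookGraph ⌈(m : ℚ) / (i : ℚ)⌉₊) : ℤ) - 1)

/-- The coloring has a rainbow triangle: three vertices whose three connecting edges have pairwise
different colors. -/
def HasRainbowTriangle {V K : Type*} (C : SimpleGraph.TopEdgeLabeling V K) : Prop :=
  ∃ (x y z : V) (hxy : x ≠ y) (hyz : y ≠ z) (hxz : x ≠ z),
    C.get x y hxy ≠ C.get y z hyz ∧ C.get y z hyz ≠ C.get x z hxz ∧ C.get x y hxy ≠ C.get x z hxz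

/-- Some color class contains a copy of `H`. -/
def HasMonochromaticCopy {V K W : Type*} (C : SimpleGraph.TopEdgeLabeling V K)
    (H : SimpleGraph W) : Prop :=
  ∃ c : K, H ⊑ C.labelGraph c

/-- A color is `m`-admissible if its edges form a graph of maximum degree at least `m`. -/
def IsAdmissible {n k : ℕ} (m : ℕ) (C : SimpleGraph.TopEdgeLabeling (Fin n) (Fin k))
    (c : Fin k) : Prop :=
  m ≤ (C.labelGraph c).maxDegree

/-- Every `k`-coloring of the complete graph on `n` vertices with at least `ℓ` different
`m`-inadmissible colors contains a rainbow triangle or a monochromatic copy of `H`. -/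
def GallaiRamseyProperty {W : Type*} (k ℓ m : ℕ) (H : SimpleGraph W) (n : ℕ) : Prop :=
  ∀ C : SimpleGraph.TopEdgeLabeling (Fin n) (Fin k),
    ℓ ≤ {c : Fin k | ¬ IsAdmissible m C c}.ncard →
      HasRainbowTriangle C ∨ HasMonochromaticCopy C H

/-- The number `gr_{k,ℓ}(K_3 : H)`, with inadmissibility taken with respect to `m`. -/
noncomputable def gallaiRamseyNumber {W : Type*} (k ℓ m : ℕ) (H : SimpleGraph W) : ℕ :=
  sInf {n : ℕ | GallaiRamseyProperty k ℓ m H n}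

/-- The explicit bound `gr_{k,ℓ,m}`; the natural-number divisions are exact where they are used
with `k ≥ 1`. -/
noncomputable def gallaiRamseyBound (k ℓ m : ℕ) : ℤ :=
  if k = 1 then (m : ℤ) + 2 - ℓ
  else if Even k then bookRamseySum m * 5 ^ ((k - 2) / 2) + 1 - ((m : ℤ) - 1) * ℓ
  else 2 * bookRamseySum m * 5 ^ ((k - 3) / 2) + 1 - ((m : ℤ) - 1) * ℓ

/-!
The proof bounds the order of a coloring of a vertex set `X` without rainbow triangles and
monochromatic `m`-page books, in which only colors from `S` occur and the colors from `I ⊆ S` are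
inadmissible, by `maxOrder m |S| |I|`. It is a strong induction on `|X|` (`card_le_maxOrder`).

One color is immediate, and for two colors `|X| < R(B_m, B_m)`. This is enough because every
summand of `R'_m` is at least `6`. For three or more colors, Gallai's theorem
(`exists_isGallaiPartition`) gives a partition of `X` such that the edges between the parts have
only two colors `r` and `b`, and a single color between any two parts. Two facts about books drive
the argument.

* If a vertex outside `A` is joined to all of `A` in color `i`, then `i` is inadmissible inside `A`
  (`colorDegree_lt_of_forall_color_eq`). If at least `m` vertices are, `i` does not occur inside
  `A` at all (`color_ne_of_join`).
* If `t_i` is the number of parts with at least `i` vertices, then `t_i < R(B_s, B_s)` for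
  `s = ⌈m / i⌉`, because books with `s` pages in the coloring of these parts blow up to books with
  `m` pages. Summing over `1 ≤ i ≤ m - 1`, the part sizes truncated at `m - 1` add up to at most
  `R'_m` (`IsReducedPartition.sum_min_le`).

If some part is joined to its complement in a single color, the induction hypothesis is applied to
the part and its complement (`card_le_maxOrder_of_join`). Otherwise every part has neighbors in both
colors, so that `r` and `b` are inadmissible inside every part. If there is a part with `m` or more
vertices, then `r` and `b` are admissible in `X`, so that inside such a large part there are two
more inadmissible colors than in `X`, or fewer colors. A large part lies in no monochromatic
triangle of parts, so that `R(3, 3) ≤ 6` leaves room for at most five large parts, and for no other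
part if there are five. How many of the large parts contain edges of color `r` or `b` decides
between the cases of `IsReducedPartition.card_le_maxOrder`; in each of them the truncated sum or a
direct count of the neighbors gives the bound.
-/

open scoped SimpleGraph

/-! ### Books and their Ramsey numbers -/

lemma bookGraph_isContained_iff {V : Type*} {m : ℕ} {G : SimpleGraph V} :
    bookGraph m ⊑ G ↔ ∃ x y, G.Adj x y ∧
      ∃ T : Finset V, m ≤ T.card ∧ ∀ z ∈ T, G.Adj x z ∧ G.Adj y z := by
  classical
  constructor
  · rintro ⟨f⟩
    refine ⟨f (.inl 0), f (.inl 1), f.toHom.map_adj (by simp [bookGraph]),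
      Finset.univ.image fun i => f (.inr i), ?_, ?_⟩
    · have hinj : Function.Injective fun i => f (.inr i) :=
        fun i j h => Sum.inr_injective (f.injective h)
      simp [Finset.card_image_of_injective _ hinj]
    · intro z hz
      obtain ⟨i, -, rfl⟩ := Finset.mem_image.1 hz
      exact ⟨f.toHom.map_adj (by simp [bookGraph]), f.toHom.map_adj (by simp [bookGraph])⟩
  · rintro ⟨x, y, hxy, T, hT, h⟩
    obtain ⟨e⟩ : Nonempty (Fin m ↪ T) := Function.Embedding.nonempty_of_card_le (by simpa using hT)
    have hx (i) : G.Adj x (e i) := (h _ (e i).2).1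
    have hy (i) : G.Adj y (e i) := (h _ (e i).2).2
    refine ⟨⟨⟨Sum.elim ![x, y] fun i => e i, ?_⟩, ?_⟩⟩
    · rintro (i | i) (j | j) hij
      · fin_cases i <;> fin_cases j <;> simp_all [bookGraph, hxy.symm]
      · fin_cases i <;> simp [hx, hy]
      · fin_cases j <;> simp [(hx _).symm, (hy _).symm]
      · simp [bookGraph] at hij
    · rintro (i | i) (j | j) hij
      · have := hxy.ne
        fin_cases i <;> fin_cases j <;> simp_all [hxy.ne.symm]
      · fin_cases i <;> simp_all [(hx _).ne, (hy _).ne]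
      · fin_cases j <;> simp_all [(hx _).ne', (hy _).ne']
      · simpa [Subtype.val_inj] using hij

/-- Ramsey's theorem for a symmetric relation, in the form of a pairwise related or a pairwise
unrelated subset of prescribed size. -/
lemma exists_forall_pairwise_or_pairwise_not (a b : ℕ) :
    ∃ N : ℕ, ∀ {α : Type} (r : α → α → Prop), (∀ x y, r x y → r y x) → ∀ X : Finset α,
      N ≤ X.card → ∃ Y ⊆ X, (Y.card = a ∧ (Y : Set α).Pairwise r) ∨
        (Y.card = b ∧ (Y : Set α).Pairwise fun x y => ¬ r x y) := by
  classical
  induction a generalizing b with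
  | zero => exact ⟨0, fun r _ X _ => ⟨∅, by simp, Or.inl (by simp)⟩⟩
  | succ a iha =>
    induction b with
    | zero => exact ⟨0, fun r _ X _ => ⟨∅, by simp, Or.inr (by simp)⟩⟩
    | succ b ihb =>
      obtain ⟨N₁, h₁⟩ := iha (b + 1)
      obtain ⟨N₂, h₂⟩ := ihb
      refine ⟨N₁ + N₂ + 1, fun {α} r hr X hX => ?_⟩
      obtain ⟨v, hv⟩ : X.Nonempty := Finset.card_pos.1 (by omega)
      have hcard : ((X.erase v).filter (r v)).card +
          ((X.erase v).filter fun x => ¬ r v x).card = X.card - 1 := by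
        rw [Finset.card_filter_add_card_filter_not, Finset.card_erase_of_mem hv]
      have hsub (p : α → Prop) [DecidablePred p] {Y : Finset α} (hY : Y ⊆ (X.erase v).filter p) :
          Y ⊆ X ∧ v ∉ Y ∧ insert v Y ⊆ X ∧ ∀ y ∈ Y, p y := by
        have hYX : Y ⊆ X := fun y hy => Finset.mem_of_mem_erase (Finset.mem_filter.1 (hY hy)).1
        exact ⟨hYX, fun h => by simpa using hY h, Finset.insert_subset hv hYX,
          fun y hy => (Finset.mem_filter.1 (hY hy)).2⟩
      rcases (by omega : N₁ ≤ ((X.erase v).filter (r v)).card ∨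
        N₂ ≤ ((X.erase v).filter fun x => ¬ r v x).card) with h | h
      · obtain ⟨Y, hY, ⟨hc, hp⟩ | ⟨hc, hp⟩⟩ := h₁ r hr _ h <;>
          obtain ⟨hYX, hvY, hins, hall⟩ := hsub _ hY
        · refine ⟨insert v Y, hins, Or.inl ⟨by simp [hvY, hc], ?_⟩⟩
          rw [Finset.coe_insert]
          exact hp.insert fun y hy _ => ⟨hall y hy, hr _ _ (hall y hy)⟩
        · exact ⟨Y, hYX, Or.inr ⟨hc, hp⟩⟩
      · obtain ⟨Y, hY, ⟨hc, hp⟩ | ⟨hc, hp⟩⟩ := h₂ r hr _ h <;>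
          obtain ⟨hYX, hvY, hins, hall⟩ := hsub _ hY
        · exact ⟨Y, hYX, Or.inl ⟨hc, hp⟩⟩
        · refine ⟨insert v Y, hins, Or.inr ⟨by simp [hvY, hc], ?_⟩⟩
          rw [Finset.coe_insert]
          exact hp.insert fun y hy _ => ⟨hall y hy, fun h => hall y hy (hr _ _ h)⟩

lemma bookGraph_isContained_of_pairwise {V : Type*} [DecidableEq V] {s : ℕ} {G : SimpleGraph V}
    {Y : Finset V} (hY : Y.card = s + 2) (h : (Y : Set V).Pairwise G.Adj) : bookGraph s ⊑ G := by
  obtain ⟨x, hx, y, hy, hxy⟩ := Finset.one_lt_card.1 (by omega : 1 < Y.card)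
  refine bookGraph_isContained_iff.2 ⟨x, y, h hx hy hxy, (Y.erase x).erase y, ?_, fun z hz => ?_⟩
  · rw [Finset.card_erase_of_mem (by simp [hy, hxy.symm]), Finset.card_erase_of_mem hx]
    omega
  · simp only [Finset.mem_erase] at hz
    exact ⟨h hx hz.2.2 (Ne.symm hz.2.1), h hy hz.2.2 (Ne.symm hz.1)⟩

lemma exists_ramseyProperty_bookGraph (s : ℕ) :
    ∃ n, RamseyProperty (bookGraph s) (bookGraph s) n := by
  obtain ⟨N, hN⟩ := exists_forall_pairwise_or_pairwise_not (s + 2) (s + 2)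
  refine ⟨N, fun C => ?_⟩
  obtain ⟨Y, -, ⟨hc, hp⟩ | ⟨hc, hp⟩⟩ := hN (C.labelGraph true).Adj (fun _ _ h => h.symm)
    Finset.univ (by simp)
  · exact Or.inl (bookGraph_isContained_of_pairwise hc hp)
  · refine Or.inr (bookGraph_isContained_of_pairwise hc fun x hx y hy hxy => ?_)
    have := hp hx hy hxy
    simp_all [SimpleGraph.TopEdgeLabeling.labelGraph_adj]

lemma ramseyProperty_ramseyNumber_bookGraph (s : ℕ) :
    RamseyProperty (bookGraph s) (bookGraph s) (ramseyNumber (bookGraph s) (bookGraph s)) :=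
  Nat.sInf_mem (exists_ramseyProperty_bookGraph s)

/-- Two disjoint red triangles joined by blue edges contain no monochromatic book with two or more
pages: a red one would need four vertices in a triangle, a blue one a blue triangle. -/
lemma seven_le_ramseyNumber_bookGraph {s : ℕ} (hs : 2 ≤ s) :
    7 ≤ ramseyNumber (bookGraph s) (bookGraph s) := by
  by_contra! hlt
  set n := ramseyNumber (bookGraph s) (bookGraph s)
  let C : SimpleGraph.TopEdgeLabeling (Fin n) Bool :=
    SimpleGraph.EdgeLabeling.mk (fun x y _ => decide (x.1 % 2 = y.1 % 2))
      fun x y _ => by simp [eq_comm]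
  have hget (x y : Fin n) (h : x ≠ y) : C.get x y h = decide (x.1 % 2 = y.1 % 2) := rfl
  rcases ramseyProperty_ramseyNumber_bookGraph s C with h | h <;>
    obtain ⟨x, y, hxy, T, hT, hz⟩ := bookGraph_isContained_iff.1 h
  · obtain ⟨z, hzT, w, hwT, hzw⟩ := Finset.one_lt_card.1 (by omega : 1 < T.card)
    have h1 := hz z hzT
    have h2 := hz w hwT
    simp only [SimpleGraph.TopEdgeLabeling.labelGraph_adj, hget, decide_eq_true_eq, exists_prop,
      ne_eq, Fin.ext_iff] at hxy h1 h2 hzw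
    have := x.2; have := y.2; have := z.2; have := w.2
    omega
  · obtain ⟨z, hzT⟩ : T.Nonempty := Finset.card_pos.1 (by omega)
    have h1 := hz z hzT
    simp only [SimpleGraph.TopEdgeLabeling.labelGraph_adj, hget, decide_eq_false_iff_not,
      exists_prop, ne_eq] at hxy h1
    omega

variable {α K : Type*}

/-- The coloring `c` has no monochromatic copy of the book with `s` pages inside `Y`: the pages on
a spine `x y` form a set of vertices joined to `x` and `y` in the color of the spine. A coloring of
the edges is encoded as a function `c` of two vertices, whose diagonal values are irrelevant. -/
def BookFreeOn (c : α → α → K) (s : ℕ) (Y : Finset α) : Prop :=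
  ∀ x ∈ Y, ∀ y ∈ Y, x ≠ y → ∀ T ⊆ Y,
    (∀ z ∈ T, z ≠ x ∧ z ≠ y ∧ c x z = c x y ∧ c y z = c x y) → T.card < s

lemma BookFreeOn.mono {c : α → α → K} {s : ℕ} {X Y : Finset α} (h : BookFreeOn c s X)
    (hY : Y ⊆ X) : BookFreeOn c s Y :=
  fun x hx y hy hxy T hT => h x (hY hx) y (hY hy) hxy T (hT.trans hY)

lemma card_lt_ramseyNumber {c : α → α → K} (hc : ∀ x y, c x y = c y x) {s : ℕ} {Y : Finset α}
    (h : BookFreeOn c s Y) {r b : K} (hrb : ∀ x ∈ Y, ∀ y ∈ Y, x ≠ y → c x y = r ∨ c x y = b) :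
    Y.card < ramseyNumber (bookGraph s) (bookGraph s) := by
  classical
  by_contra! hle
  set n := ramseyNumber (bookGraph s) (bookGraph s)
  obtain ⟨e⟩ : Nonempty (Fin n ↪ Y) := Function.Embedding.nonempty_of_card_le (by simpa using hle)
  let C : SimpleGraph.TopEdgeLabeling (Fin n) Bool :=
    SimpleGraph.EdgeLabeling.mk (fun x y _ => decide (c (e x) (e y) = r))
      fun x y _ => by simp [hc (e x)]
  have hget (x y : Fin n) (h : x ≠ y) : C.get x y h = decide (c (e x) (e y) = r) := rfl
  have hne {x y : Fin n} (hxy : x ≠ y) : (e x : α) ≠ e y := fun h =>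
    hxy (e.injective (Subtype.ext h))
  have key (t : Bool) (i : K) (hti : ∀ x y : Fin n, x ≠ y → (C.labelGraph t).Adj x y →
      c (e x) (e y) = i) : ¬ bookGraph s ⊑ C.labelGraph t := by
    intro hb
    obtain ⟨x, y, hxy, T, hT, hz⟩ := bookGraph_isContained_iff.1 hb
    have := h (e x) (e x).2 (e y) (e y).2 (hne hxy.ne)
      (T.map (e.trans (Function.Embedding.subtype _))) (by
        intro z hz
        obtain ⟨w, -, rfl⟩ := Finset.mem_map.1 hz
        exact (e w).2) (by
        intro z hz'
        obtain ⟨w, hw, rfl⟩ := Finset.mem_map.1 hz'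
        have h1 := (hz w hw).1
        have h2 := (hz w hw).2
        refine ⟨hne h1.ne', hne h2.ne', ?_, ?_⟩
        · exact (hti _ _ h1.ne h1).trans (hti _ _ hxy.ne hxy).symm
        · exact (hti _ _ h2.ne h2).trans (hti _ _ hxy.ne hxy).symm)
    rw [Finset.card_map] at this
    omega
  rcases ramseyProperty_ramseyNumber_bookGraph s C with h | h
  · refine key true r (fun x y hxy hadj => ?_) h
    simpa [SimpleGraph.TopEdgeLabeling.labelGraph_adj, hget, hxy] using hadj
  · refine key false b (fun x y hxy hadj => ?_) h
    refine (hrb _ (e x).2 _ (e y).2 (hne hxy)).resolve_left ?_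
    simpa [SimpleGraph.TopEdgeLabeling.labelGraph_adj, hget, hxy] using hadj

/-! ### Gallai partitions -/

/-- Among any three vertices, some two of the three edges have the same color. -/
def NoRainbow (c : α → α → K) : Prop :=
  ∀ x y z, x ≠ y → y ≠ z → x ≠ z → c x y = c y z ∨ c y z = c x z ∨ c x y = c x z

/-- The graph of the edges of color `i` inside `X`; the vertices outside `X` are isolated. -/
def colorGraph (c : α → α → K) (X : Finset α) (i : K) : SimpleGraph α :=
  SimpleGraph.fromRel fun x y => x ∈ X ∧ y ∈ X ∧ c x y = i ∧ c y x = i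

lemma colorGraph_adj {c : α → α → K} (hc : ∀ x y, c x y = c y x) {X : Finset α} {i : K} {x y : α} :
    (colorGraph c X i).Adj x y ↔ x ≠ y ∧ x ∈ X ∧ y ∈ X ∧ c x y = i := by
  have := hc x y
  simp only [colorGraph, SimpleGraph.fromRel_adj]
  grind

/-- In a coloring without rainbow triangles, a vertex outside a component of some color class sees
the whole component in a single color. -/
lemma color_eq_of_reachable {c : α → α → K} (hc : ∀ x y, c x y = c y x) (hG : NoRainbow c)
    {X : Finset α} {i : K} {w x y : α} (hw : w ∈ X) (hxy : (colorGraph c X i).Reachable x y)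
    (hwx : ¬ (colorGraph c X i).Reachable w x) : c w x = c w y := by
  obtain ⟨p⟩ := hxy
  induction p with
  | nil => rfl
  | @cons u v _ h q ih =>
    have hwv : ¬ (colorGraph c X i).Reachable w v := fun h' => hwx (h'.trans h.symm.reachable)
    rw [← ih hwv]
    obtain ⟨huv, hu, hv, hi⟩ := (colorGraph_adj hc).1 h
    have h1 : w ≠ u := fun h => hwx (h ▸ .rfl)
    have h2 : w ≠ v := fun h => hwv (h ▸ .rfl)
    have h3 : c w u ≠ i := fun h =>
      hwx ((colorGraph_adj hc).2 ⟨h1, hw, hu, h⟩ : (colorGraph c X i).Adj w u).reachable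
    have h4 : c w v ≠ i := fun h =>
      hwv ((colorGraph_adj hc).2 ⟨h2, hw, hv, h⟩ : (colorGraph c X i).Adj w v).reachable
    rcases hG w u v h1 huv h2 with h | h | h
    · exact absurd (h.trans hi) h3
    · exact absurd (h.symm.trans hi) h4
    · exact h

lemma exists_adj_of_reachable {V : Type*} {G : SimpleGraph V} {x y : V} (h : G.Reachable x y)
    (hxy : x ≠ y) : ∃ z, G.Adj x z := by
  obtain ⟨p⟩ := h
  cases p with
  | nil => exact absurd rfl hxy
  | cons h _ => exact ⟨_, h⟩

lemma exists_reachable_erase [DecidableEq α] {c : α → α → K} (hc : ∀ x y, c x y = c y x)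
    {X : Finset α} {i : K} {u v : α} (h : (colorGraph c X i).Reachable u v) (huv : u ≠ v) :
    ∃ w ∈ X.erase v, (colorGraph c (X.erase v) i).Reachable u w ∧ c v w = i := by
  obtain ⟨p⟩ := h
  induction p with
  | nil => exact absurd rfl huv
  | @cons a a' v h q ih =>
    obtain ⟨hne, ha, ha', hi⟩ := (colorGraph_adj hc).1 h
    by_cases hv : a' = v
    · subst hv
      exact ⟨a, Finset.mem_erase.2 ⟨huv, ha⟩, .rfl, (hc _ _).trans hi⟩
    · obtain ⟨w, hw, hr, hcw⟩ := ih hv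
      have hadj : (colorGraph c (X.erase v) i).Adj a a' :=
        (colorGraph_adj hc).2 ⟨hne, Finset.mem_erase.2 ⟨huv, ha⟩, Finset.mem_erase.2 ⟨hv, ha'⟩, hi⟩
      exact ⟨w, hw, hadj.reachable.trans hr, hcw⟩

/-- In a coloring without rainbow triangles, at least one of any three colors has a disconnected
color class. The induction deletes a vertex `v`. If color `i` is then disconnected but
becomes connected by adding `v`, then `v` sends an edge of color `i` to every component; edges from
`v` of two further colors lead to a contradiction, as they determine the colors between
components. -/
lemma exists_not_reachable [DecidableEq α] [DecidableEq K] {c : α → α → K}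
    (hc : ∀ x y, c x y = c y x) (hG : NoRainbow c) {S : Finset K} (hS : 3 ≤ S.card)
    {X : Finset α} (hX : 2 ≤ X.card) :
    ∃ i ∈ S, ∃ x ∈ X, ∃ y ∈ X, ¬ (colorGraph c X i).Reachable x y := by
  induction hn : X.card generalizing X with
  | zero => omega
  | succ n ih =>
    obtain ⟨v, hv, w, hw, hvw⟩ := Finset.one_lt_card.1 (by omega : 1 < X.card)
    by_cases hn2 : n = 1
    · obtain ⟨i, hi⟩ : (S.erase (c v w)).Nonempty := by
        rw [← Finset.card_pos]
        have := Finset.pred_card_le_card_erase (s := S) (a := c v w)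
        omega
      have hX2 : ({v, w} : Finset α) = X := Finset.eq_of_subset_of_card_le
        (by simp [Finset.insert_subset_iff, hv, hw]) (by rw [Finset.card_pair hvw]; omega)
      refine ⟨i, Finset.mem_of_mem_erase hi, v, hv, w, hw, fun hr => ?_⟩
      obtain ⟨z, hz⟩ := exists_adj_of_reachable hr hvw
      obtain ⟨hvz, -, hzX, hi'⟩ := (colorGraph_adj hc).1 hz
      rw [← hX2] at hzX
      have : z = w := by simpa [Ne.symm hvz] using hzX
      subst this
      exact (Finset.ne_of_mem_erase hi) hi'.symm
    by_contra! hcon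
    have hcard : (X.erase v).card = n := by rw [Finset.card_erase_of_mem hv]; omega
    obtain ⟨i, hi, x₀, hx₀, y₀, hy₀, h₀⟩ := ih (by omega) hcard
    obtain ⟨d, hd, e, he, hde⟩ := Finset.one_lt_card.1 (by
      rw [Finset.card_erase_of_mem hi]; omega : 1 < (S.erase i).card)
    have hnbr {j} (hj : j ∈ S.erase i) : ∃ x ∈ X.erase v, c v x = j := by
      obtain ⟨x, hx⟩ := exists_adj_of_reachable
        (hcon j (Finset.mem_of_mem_erase hj) v hv w hw) hvw
      obtain ⟨h1, -, h2, h3⟩ := (colorGraph_adj hc).1 hx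
      exact ⟨x, Finset.mem_erase.2 ⟨h1.symm, h2⟩, h3⟩
    have key {x u j} (hx : x ∈ X.erase v) (hj : j ∈ S.erase i) (hvx : c v x = j)
        (hu : u ∈ X.erase v) (hxu : ¬ (colorGraph c (X.erase v) i).Reachable x u) :
        c x u = j := by
      obtain ⟨t, ht, hr, hvt⟩ := exists_reachable_erase hc
        (hcon i hi u (Finset.mem_of_mem_erase hu) v hv) (Finset.ne_of_mem_erase hu)
      have hxt : ¬ (colorGraph c (X.erase v) i).Reachable x t := fun h => hxu (h.trans hr.symm)
      have hne : x ≠ t := fun h => hxt (h ▸ .rfl)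
      rw [color_eq_of_reachable hc hG hx hr hxu]
      have h1 : c x t ≠ i := fun h => hxt
        ((colorGraph_adj hc).2 ⟨hne, hx, ht, h⟩ : (colorGraph c (X.erase v) i).Adj x t).reachable
      have h2 := Finset.ne_of_mem_erase hj
      rcases hG v x t (Finset.ne_of_mem_erase hx).symm hne (Finset.ne_of_mem_erase ht).symm with
        h | h | h
      · exact h.symm.trans hvx
      · exact absurd (h.trans hvt) h1
      · exact absurd (hvx.symm.trans (h.trans hvt)) h2
    obtain ⟨x, hx, hvx⟩ := hnbr hd
    obtain ⟨y, hy, hvy⟩ := hnbr he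
    by_cases hxy : (colorGraph c (X.erase v) i).Reachable x y
    · obtain ⟨z, hz, hxz⟩ : ∃ z ∈ X.erase v, ¬ (colorGraph c (X.erase v) i).Reachable x z := by
        by_contra! h
        exact h₀ ((h x₀ hx₀).symm.trans (h y₀ hy₀))
      have h1 := key hx hd hvx hz hxz
      have h2 := key hy he hvy hz fun h => hxz (hxy.trans h)
      have h3 := color_eq_of_reachable hc hG hz hxy fun h => hxz h.symm
      rw [hc z, hc z, h1, h2] at h3
      exact hde h3
    · have h1 := key hx hd hvx hy hxy
      have h2 := key hy he hvy hx fun h => hxy h.symm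
      exact hde (h1.symm.trans ((hc x y).trans h2))

/-- A Gallai partition of `X` with colors `r` and `b`, encoded by the map `f` that sends each
vertex to a representative of its part: the color of an edge between different parts is `r` or `b`
and depends on the two parts only. -/
structure IsGallaiPartition (c : α → α → K) (X : Finset α) (f : α → α) (r b : K) : Prop where
  mem : ∀ x ∈ X, f x ∈ X
  idem : ∀ x ∈ X, f (f x) = f x
  color_eq : ∀ x ∈ X, ∀ y ∈ X, f x ≠ f y → c x y = c (f x) (f y)
  color_mem : ∀ x ∈ X, ∀ y ∈ X, f x ≠ f y → c x y = r ∨ c x y = b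

lemma IsGallaiPartition.symm {c : α → α → K} {X : Finset α} {f : α → α} {r b : K}
    (h : IsGallaiPartition c X f r b) : IsGallaiPartition c X f b r :=
  ⟨h.mem, h.idem, h.color_eq, fun x hx y hy hxy => (h.color_mem x hx y hy hxy).symm⟩

/-- Gallai's theorem. A disconnected color class is contracted to its components, on which that
color no longer occurs, until at most two colors are left. -/
theorem exists_isGallaiPartition [DecidableEq α] [DecidableEq K] {c : α → α → K}
    (hc : ∀ x y, c x y = c y x) (hG : NoRainbow c) {S : Finset K} {X : Finset α}
    (hX : 2 ≤ X.card) (hS : ∀ x ∈ X, ∀ y ∈ X, x ≠ y → c x y ∈ S) :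
    ∃ f r b, IsGallaiPartition c X f r b ∧ ∃ x ∈ X, ∃ y ∈ X, f x ≠ f y := by
  classical
  induction hn : S.card generalizing S X with
  | zero =>
    obtain ⟨x, hx, y, hy, hxy⟩ := Finset.one_lt_card.1 (by omega : 1 < X.card)
    simpa [Finset.card_eq_zero.1 hn] using hS x hx y hy hxy
  | succ n ih =>
    by_cases hS3 : 3 ≤ S.card
    · obtain ⟨i, hi, x₀, hx₀, y₀, hy₀, h₀⟩ := exists_not_reachable hc hG hS3 hX
      set R := (colorGraph c X i).Reachable
      have hRX {x y} (h : R x y) (hx : x ∈ X) : y ∈ X := by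
        by_cases hxy : x = y
        · exact hxy ▸ hx
        · obtain ⟨z, hz⟩ := exists_adj_of_reachable h.symm (Ne.symm hxy)
          exact ((colorGraph_adj hc).1 hz).2.1
      let g : α → α := fun x => ((colorGraph c X i).connectedComponentMk x).out
      have hg (x) : R (g x) x := SimpleGraph.ConnectedComponent.exact (Quot.out_eq _)
      have hgX {x} (hx : x ∈ X) : g x ∈ X := hRX (hg x).symm hx
      have hgeq {x y} : g x = g y ↔ R x y := by
        refine ⟨fun h => (hg x).symm.trans (h ▸ hg y), fun h => ?_⟩
        exact congrArg Quot.out (SimpleGraph.ConnectedComponent.sound h)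
      have hgg (x) : g (g x) = g x := hgeq.2 (hg x)
      have hgc {x y} (hx : x ∈ X) (hy : y ∈ X) (hxy : g x ≠ g y) : c x y = c (g x) (g y) := by
        have h1 : ¬ R x y := fun h => hxy (hgeq.2 h)
        have h2 : ¬ R (g y) x := fun h => h1 (h.symm.trans (hg y))
        rw [color_eq_of_reachable hc hG hx (hg y).symm h1, hc, hc (g x)]
        exact color_eq_of_reachable hc hG (hgX hy) (hg x).symm h2
      have himg {p} (hp : p ∈ X.image g) : p ∈ X ∧ g p = p := by
        obtain ⟨x, hx, rfl⟩ := Finset.mem_image.1 hp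
        exact ⟨hgX hx, hgg x⟩
      have hgi (p) (hp : p ∈ X.image g) (q) (hq : q ∈ X.image g) (hpq : p ≠ q) : c p q ≠ i := by
        intro h
        apply hpq
        rw [← (himg hp).2, ← (himg hq).2]
        exact hgeq.2 ((colorGraph_adj hc).2
          ⟨hpq, (himg hp).1, (himg hq).1, h⟩ : (colorGraph c X i).Adj p q).reachable
      obtain ⟨f, r, b, hf, x₁, hx₁, y₁, hy₁, hne⟩ := ih (S := S.erase i) (X := X.image g)
        (Finset.one_lt_card.2 ⟨g x₀, Finset.mem_image_of_mem g hx₀, g y₀,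
          Finset.mem_image_of_mem g hy₀, fun h => h₀ (hgeq.1 h)⟩)
        (fun p hp q hq hpq => Finset.mem_erase.2 ⟨hgi p hp q hq hpq,
          hS p (himg hp).1 q (himg hq).1 hpq⟩)
        (by rw [Finset.card_erase_of_mem hi]; omega)
      have hm {x} (hx : x ∈ X) : g x ∈ X.image g := Finset.mem_image_of_mem g hx
      refine ⟨f ∘ g, r, b, ⟨?_, ?_, ?_, ?_⟩, x₁, (himg hx₁).1, y₁, (himg hy₁).1, ?_⟩
      · exact fun x hx => (himg (hf.mem _ (hm hx))).1
      · intro x hx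
        simp only [Function.comp_apply]
        rw [(himg (hf.mem _ (hm hx))).2, hf.idem _ (hm hx)]
      · intro x hx y hy hxy
        rw [hgc hx hy fun h => hxy (congrArg f h)]
        exact hf.color_eq _ (hm hx) _ (hm hy) hxy
      · intro x hx y hy hxy
        rw [hgc hx hy fun h => hxy (congrArg f h)]
        exact hf.color_mem _ (hm hx) _ (hm hy) hxy
      · simpa [(himg hx₁).2, (himg hy₁).2] using hne
    · obtain ⟨x, hx, y, hy, hxy⟩ := Finset.one_lt_card.1 (by omega : 1 < X.card)
      obtain ⟨r, b, hrb⟩ : ∃ r b : K, S ⊆ {r, b} := by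
        rcases (by omega : S.card = 1 ∨ S.card = 2) with h | h
        · obtain ⟨r, rfl⟩ := Finset.card_eq_one.1 h
          exact ⟨r, r, by simp⟩
        · obtain ⟨r, b, -, rfl⟩ := Finset.card_eq_two.1 h
          exact ⟨r, b, subset_rfl⟩
      refine ⟨id, r, b, ⟨fun x hx => hx, fun x _ => rfl, fun x _ y _ _ => rfl, ?_⟩,
        x, hx, y, hy, hxy⟩
      intro x hx y hy hxy
      simpa using hrb (hS x hx y hy hxy)

/-! ### The numerical bound -/

/-- All summands of `bookRamseySum m` are at least `6`, and the first is `R(B_m, B_m) - 1`. -/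
lemma ramseyNumber_add_le_bookRamseySum {m : ℕ} (hm : 3 ≤ m) :
    (ramseyNumber (bookGraph m) (bookGraph m) : ℤ) - 1 + 6 * (m - 2) ≤ bookRamseySum m := by
  have hs (i : ℕ) (hi : i ∈ Finset.Icc 2 (m - 1)) :
      (6 : ℤ) ≤ (ramseyNumber (bookGraph ⌈(m : ℚ) / (i : ℚ)⌉₊)
        (bookGraph ⌈(m : ℚ) / (i : ℚ)⌉₊) : ℤ) - 1 := by
    rw [Finset.mem_Icc] at hi
    have h2 : 2 ≤ ⌈(m : ℚ) / (i : ℚ)⌉₊ := by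
      have hi0 : (0 : ℚ) < i := by exact_mod_cast (by omega : 0 < i)
      have him : (i : ℚ) < m := by exact_mod_cast (by omega : i < m)
      rw [Nat.succ_le_iff, Nat.lt_ceil, Nat.cast_one, lt_div_iff₀ hi0]
      simpa using him
    have := seven_le_ramseyNumber_bookGraph h2
    omega
  have hsum := Finset.sum_le_sum hs
  have hcard : (Finset.Icc 2 (m - 1)).card = m - 2 := by simp; omega
  have hsplit : Finset.Icc 1 (m - 1) = insert 1 (Finset.Icc 2 (m - 1)) := by
    ext; simp; omega
  have hone : ⌈(m : ℚ) / ((1 : ℕ) : ℚ)⌉₊ = m := by simp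
  rw [bookRamseySum, hsplit, Finset.sum_insert (by simp), hone]
  rw [Finset.sum_const, hcard, nsmul_eq_mul, Nat.cast_sub (by omega)] at hsum
  push_cast at hsum
  linarith

lemma six_mul_le_bookRamseySum {m : ℕ} (hm : 3 ≤ m) : 6 * ((m : ℤ) - 1) ≤ bookRamseySum m := by
  have h1 := ramseyNumber_add_le_bookRamseySum hm
  have h2 : 7 ≤ ramseyNumber (bookGraph m) (bookGraph m) :=
    seven_le_ramseyNumber_bookGraph (by omega)
  have : (7 : ℤ) ≤ ramseyNumber (bookGraph m) (bookGraph m) := by exact_mod_cast h2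
  linarith

/-- The bound for `k ≥ 2` colors, none of which is required to be inadmissible. -/
noncomputable def bookGrowth (m k : ℕ) : ℤ :=
  if Even k then bookRamseySum m * 5 ^ ((k - 2) / 2) else 2 * bookRamseySum m * 5 ^ ((k - 3) / 2)

lemma gallaiRamseyBound_eq {k ℓ m : ℕ} (hk : 2 ≤ k) :
    gallaiRamseyBound k ℓ m = bookGrowth m k + 1 - ((m : ℤ) - 1) * ℓ := by
  rw [gallaiRamseyBound, if_neg (by omega), bookGrowth]
  split_ifs <;> rfl

lemma gallaiRamseyBound_one (ℓ m : ℕ) : gallaiRamseyBound 1 ℓ m = (m : ℤ) + 2 - ℓ := by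
  rw [gallaiRamseyBound, if_pos rfl]

lemma bookGrowth_even (m a : ℕ) : bookGrowth m (2 * a + 2) = bookRamseySum m * 5 ^ a := by
  rw [bookGrowth, if_pos (by simp [parity_simps])]
  congr 2
  omega

lemma bookGrowth_odd (m a : ℕ) : bookGrowth m (2 * a + 3) = 2 * bookRamseySum m * 5 ^ a := by
  rw [bookGrowth, if_neg (by simp [parity_simps])]
  congr 2
  omega

lemma bookGrowth_two (m : ℕ) : bookGrowth m 2 = bookRamseySum m := by
  simpa using bookGrowth_even m 0

lemma bookGrowth_three (m : ℕ) : bookGrowth m 3 = 2 * bookRamseySum m := by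
  simpa using bookGrowth_odd m 0

lemma exists_eq_two_mul_add {k : ℕ} (hk : 2 ≤ k) : ∃ a, k = 2 * a + 2 ∨ k = 2 * a + 3 :=
  ⟨(k - 2) / 2, by omega⟩

lemma bookGrowth_add_two {m k : ℕ} (hk : 2 ≤ k) : bookGrowth m (k + 2) = 5 * bookGrowth m k := by
  obtain ⟨a, rfl | rfl⟩ := exists_eq_two_mul_add hk
  · rw [show 2 * a + 2 + 2 = 2 * (a + 1) + 2 by ring, bookGrowth_even, bookGrowth_even]
    ring
  · rw [show 2 * a + 3 + 2 = 2 * (a + 1) + 3 by ring, bookGrowth_odd, bookGrowth_odd]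
    ring

lemma bookRamseySum_le_mul_pow {m : ℕ} (hm : 3 ≤ m) (a : ℕ) :
    bookRamseySum m ≤ bookRamseySum m * 5 ^ a :=
  le_mul_of_one_le_right (by have := six_mul_le_bookRamseySum hm; omega)
    (one_le_pow₀ (by norm_num))

lemma two_mul_bookGrowth_le {m k : ℕ} (hm : 3 ≤ m) (hk : 2 ≤ k) :
    2 * bookGrowth m k ≤ bookGrowth m (k + 1) := by
  obtain ⟨a, rfl | rfl⟩ := exists_eq_two_mul_add hk
  · rw [show 2 * a + 2 + 1 = 2 * a + 3 by ring, bookGrowth_even, bookGrowth_odd]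
    linarith
  · rw [show 2 * a + 3 + 1 = 2 * (a + 1) + 2 by ring, bookGrowth_even, bookGrowth_odd, pow_succ]
    have := bookRamseySum_le_mul_pow hm a
    have := six_mul_le_bookRamseySum hm
    linarith

lemma bookGrowth_succ_add_le {m k : ℕ} (hm : 3 ≤ m) (hk : 2 ≤ k) :
    bookGrowth m (k + 1) + bookRamseySum m ≤ 3 * bookGrowth m k := by
  obtain ⟨a, rfl | rfl⟩ := exists_eq_two_mul_add hk <;>
    have := bookRamseySum_le_mul_pow hm a
  · rw [show 2 * a + 2 + 1 = 2 * a + 3 by ring, bookGrowth_even, bookGrowth_odd]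
    linarith
  · rw [show 2 * a + 3 + 1 = 2 * (a + 1) + 2 by ring, bookGrowth_even, bookGrowth_odd, pow_succ]
    linarith

lemma bookRamseySum_add_le_bookGrowth {m k : ℕ} (hm : 3 ≤ m) (hk : 3 ≤ k) :
    bookRamseySum m + ((m : ℤ) - 1) * k ≤ bookGrowth m k := by
  have h6 := six_mul_le_bookRamseySum hm
  induction k, hk using Nat.le_induction with
  | base => rw [bookGrowth_three]; push_cast; linarith
  | succ k hk ih =>
    have h1 := two_mul_bookGrowth_le (k := k) hm (by omega)
    have : 0 ≤ ((m : ℤ) - 1) * k := mul_nonneg (by omega) (by omega)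
    push_cast
    linarith

/-- The largest order that the bound leaves open to a coloring with `k ≥ 1` colors, at least `ℓ` of
them inadmissible, without the forbidden subgraphs. -/
noncomputable def maxOrder (m k ℓ : ℕ) : ℤ := gallaiRamseyBound k ℓ m - 1

lemma maxOrder_eq {m k ℓ : ℕ} (hk : 2 ≤ k) :
    maxOrder m k ℓ = bookGrowth m k - ((m : ℤ) - 1) * ℓ := by
  rw [maxOrder, gallaiRamseyBound_eq hk]
  ring

lemma maxOrder_one (m ℓ : ℕ) : maxOrder m 1 ℓ = m + 1 - ℓ := by
  rw [maxOrder, gallaiRamseyBound_one]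
  ring

lemma maxOrder_add_one {m k ℓ : ℕ} (hk : 2 ≤ k) :
    maxOrder m k (ℓ + 1) + (m - 1) = maxOrder m k ℓ := by
  rw [maxOrder_eq hk, maxOrder_eq hk]
  push_cast
  ring

lemma bookRamseySum_le_maxOrder {m k ℓ : ℕ} (hm : 3 ≤ m) (hk : 3 ≤ k) (hℓ : ℓ ≤ k) :
    bookRamseySum m ≤ maxOrder m k ℓ := by
  have h1 := bookRamseySum_add_le_bookGrowth hm hk
  have h2 : ((m : ℤ) - 1) * ℓ ≤ ((m : ℤ) - 1) * k :=
    mul_le_mul_of_nonneg_left (by exact_mod_cast hℓ) (by omega)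
  rw [maxOrder_eq (by omega)]
  linarith

lemma ramseyNumber_le_maxOrder {m ℓ : ℕ} (hm : 3 ≤ m) (hℓ : ℓ ≤ 2) :
    (ramseyNumber (bookGraph m) (bookGraph m) : ℤ) - 1 ≤ maxOrder m 2 ℓ := by
  have h1 := ramseyNumber_add_le_bookRamseySum hm
  have h2 : ((m : ℤ) - 1) * ℓ ≤ ((m : ℤ) - 1) * 2 :=
    mul_le_mul_of_nonneg_left (by exact_mod_cast hℓ) (by omega)
  rw [maxOrder_eq le_rfl, bookGrowth_two]
  linarith [(by exact_mod_cast hm : (3 : ℤ) ≤ m)]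

/-- Two sets in which one of the `k + 1` colors does not occur. -/
lemma two_mul_maxOrder_le {m k ℓ : ℕ} (hm : 3 ≤ m) (hk : 2 ≤ k) :
    2 * maxOrder m k ℓ ≤ maxOrder m (k + 1) ℓ := by
  have h1 := two_mul_bookGrowth_le hm hk
  have : 0 ≤ ((m : ℤ) - 1) * ℓ := mul_nonneg (by omega) (by omega)
  rw [maxOrder_eq hk, maxOrder_eq (by omega)]
  linarith

lemma le_maxOrder {m k ℓ : ℕ} (hm : 3 ≤ m) (hk : 1 ≤ k) (hℓ : ℓ ≤ k) :
    (m : ℤ) - 1 ≤ maxOrder m k ℓ := by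
  have h6 := six_mul_le_bookRamseySum hm
  have hM : (3 : ℤ) ≤ m := by exact_mod_cast hm
  rcases (by omega : k = 1 ∨ k = 2 ∨ 3 ≤ k) with rfl | rfl | hk
  · rw [maxOrder_one]
    omega
  · have h7 : (7 : ℤ) ≤ ramseyNumber (bookGraph m) (bookGraph m) := by
      exact_mod_cast seven_le_ramseyNumber_bookGraph (by omega)
    have h1 : ((m : ℤ) - 1) * ℓ ≤ ((m : ℤ) - 1) * 2 :=
      mul_le_mul_of_nonneg_left (by exact_mod_cast hℓ) (by omega)
    rw [maxOrder_eq le_rfl, bookGrowth_two]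
    linarith
  · linarith [bookRamseySum_le_maxOrder hm hk hℓ]

/-- Five large parts, in which two of the `k + 2` colors do not occur. -/
lemma five_mul_maxOrder_le {m k ℓ : ℕ} (hm : 3 ≤ m) (hk : 1 ≤ k) (hℓ : ℓ ≤ k) :
    5 * maxOrder m k ℓ ≤ maxOrder m (k + 2) ℓ := by
  have h6 := six_mul_le_bookRamseySum hm
  have hM : (3 : ℤ) ≤ m := by exact_mod_cast hm
  have h0 : 0 ≤ ((m : ℤ) - 1) * ℓ := mul_nonneg (by omega) (by omega)
  rcases (by omega : k = 1 ∨ 2 ≤ k) with rfl | hk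
  · rw [maxOrder_one, maxOrder_eq (by omega), bookGrowth_three]
    interval_cases ℓ <;> push_cast <;> linarith
  · rw [maxOrder_eq hk, maxOrder_eq (by omega), bookGrowth_add_two hk]
    linarith

/-- At most four large parts, in which two of the `k + 2` colors do not occur, exceed the truncated
sum of the part sizes. -/
lemma bookRamseySum_add_four_mul_le {m k ℓ : ℕ} (hm : 3 ≤ m) (hk : 1 ≤ k) (hℓ : ℓ ≤ k) :
    bookRamseySum m + 4 * (maxOrder m k ℓ - (m - 1)) ≤ maxOrder m (k + 2) ℓ := by
  have h6 := six_mul_le_bookRamseySum hm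
  have hM : (3 : ℤ) ≤ m := by exact_mod_cast hm
  have h0 : 0 ≤ ((m : ℤ) - 1) * ℓ := mul_nonneg (by omega) (by omega)
  rcases (by omega : k = 1 ∨ 2 ≤ k) with rfl | hk
  · rw [maxOrder_one, maxOrder_eq (by omega), bookGrowth_three]
    interval_cases ℓ <;> push_cast <;> linarith
  · have hR : bookRamseySum m ≤ bookGrowth m k := by
      rcases (by omega : k = 2 ∨ 3 ≤ k) with rfl | hk3
      · rw [bookGrowth_two]
      · have := bookRamseySum_add_le_bookGrowth hm hk3
        have : 0 ≤ ((m : ℤ) - 1) * k := mul_nonneg (by omega) (by omega)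
        linarith
    rw [maxOrder_eq hk, maxOrder_eq (by omega), bookGrowth_add_two hk]
    linarith

/-- A large part in which one of the `k + 2` colors does not occur and another one becomes
inadmissible, and at most two large parts in which both do not occur. For `k = 1` the inequality
amounts to `2 ≤ m - 1 + ℓ`, which holds for `m ≥ 3`. -/
lemma bookRamseySum_add_maxOrder_add_two_mul_le {m k ℓ : ℕ} (hm : 3 ≤ m) (hk : 1 ≤ k)
    (hℓ : ℓ ≤ k) :
    bookRamseySum m + (maxOrder m (k + 1) (ℓ + 1) - (m - 1)) + 2 * (maxOrder m k ℓ - (m - 1)) ≤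
      maxOrder m (k + 2) ℓ := by
  have h6 := six_mul_le_bookRamseySum hm
  have hM : (3 : ℤ) ≤ m := by exact_mod_cast hm
  have h0 : 0 ≤ ((m : ℤ) - 1) * ℓ := mul_nonneg (by omega) (by omega)
  rcases (by omega : k = 1 ∨ 2 ≤ k) with rfl | hk
  · rw [maxOrder_one, maxOrder_eq (by omega), maxOrder_eq (by omega), bookGrowth_two,
      bookGrowth_three]
    interval_cases ℓ <;> push_cast <;> linarith
  · have := bookGrowth_succ_add_le hm hk
    rw [maxOrder_eq hk, maxOrder_eq (by omega), maxOrder_eq (by omega), bookGrowth_add_two hk]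
    push_cast
    linarith

/-! ### Inadmissible colors and homogeneous sets -/

section Inadmissible

variable [DecidableEq α] [DecidableEq K]

/-- The number of edges of color `i` from `x` to the rest of `X`. -/
def colorDegree (c : α → α → K) (X : Finset α) (i : K) (x : α) : ℕ :=
  (X.filter fun y => y ≠ x ∧ c x y = i).card

/-- The coloring of `X` uses colors from `S` only, and the colors from `I` are
`m`-inadmissible. -/
structure IsAllowed (c : α → α → K) (m : ℕ) (X : Finset α) (S I : Finset K) : Prop where
  color_mem : ∀ x ∈ X, ∀ y ∈ X, x ≠ y → c x y ∈ S
  subset : I ⊆ S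
  degree_lt : ∀ i ∈ I, ∀ x ∈ X, colorDegree c X i x < m

variable {c : α → α → K} {m : ℕ} {X A : Finset α} {S I : Finset K} {i : K}

lemma colorDegree_mono (hA : A ⊆ X) (x : α) : colorDegree c A i x ≤ colorDegree c X i x :=
  Finset.card_le_card (Finset.filter_subset_filter _ hA)

lemma IsAllowed.mono (h : IsAllowed c m X S I) (hA : A ⊆ X) : IsAllowed c m A S I where
  color_mem x hx y hy := h.color_mem x (hA hx) y (hA hy)
  subset := h.subset
  degree_lt i hi x hx := (colorDegree_mono hA x).trans_lt (h.degree_lt i hi x (hA hx))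

lemma IsAllowed.insert (h : IsAllowed c m X S I) (hi : i ∈ S)
    (hdeg : ∀ x ∈ X, colorDegree c X i x < m) : IsAllowed c m X S (insert i I) where
  color_mem := h.color_mem
  subset := Finset.insert_subset hi h.subset
  degree_lt j hj := by
    rcases Finset.mem_insert.1 hj with rfl | hj
    · exact hdeg
    · exact h.degree_lt j hj

lemma IsAllowed.erase (h : IsAllowed c m X S I) (hiI : i ∉ I)
    (hi : ∀ x ∈ X, ∀ y ∈ X, x ≠ y → c x y ≠ i) : IsAllowed c m X (S.erase i) I where
  color_mem x hx y hy hxy := Finset.mem_erase.2 ⟨hi x hx y hy hxy, h.color_mem x hx y hy hxy⟩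
  subset := Finset.subset_erase.2 ⟨h.subset, hiI⟩
  degree_lt := h.degree_lt

/-- If `w` is joined to `A` in color `i`, then `i` is inadmissible in `A`: the neighbors of
`x ∈ A` in color `i` are the pages of a book with spine `x w`. -/
lemma colorDegree_lt_of_forall_color_eq (hc : ∀ x y, c x y = c y x) (hX : BookFreeOn c m X)
    (hA : A ⊆ X) {w : α} (hw : w ∈ X) (h : ∀ a ∈ A, a ≠ w ∧ c a w = i) :
    ∀ x ∈ A, colorDegree c A i x < m := by
  intro x hx
  refine hX x (hA hx) w hw (h x hx).1 _ ((Finset.filter_subset _ _).trans hA) fun z hz => ?_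
  obtain ⟨hzA, hzx, hi⟩ := Finset.mem_filter.1 hz
  exact ⟨hzx, (h z hzA).1, hi.trans (h x hx).2.symm,
    (hc w z).trans ((h z hzA).2.trans (h x hx).2.symm)⟩

omit [DecidableEq α] [DecidableEq K] in
/-- If `A` is joined to at least `m` vertices in color `i`, then `i` does not occur in `A`: these
vertices are the pages of a book whose spine is an edge of `A`. -/
lemma color_ne_of_join (hX : BookFreeOn c m X) (hA : A ⊆ X) {W : Finset α} (hW : W ⊆ X)
    (hm : m ≤ W.card) (h : ∀ a ∈ A, ∀ w ∈ W, a ≠ w ∧ c a w = i) :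
    ∀ x ∈ A, ∀ y ∈ A, x ≠ y → c x y ≠ i := by
  intro x hx y hy hxy hi
  have := hX x (hA hx) y (hA hy) hxy W hW fun w hw =>
    ⟨(h x hx w hw).1.symm, (h y hy w hw).1.symm, (h x hx w hw).2.trans hi.symm,
      (h y hy w hw).2.trans hi.symm⟩
  omega

lemma IsAllowed.notMem_of_forall_color_eq (h : IsAllowed c m X S I) (hc : ∀ x y, c x y = c y x)
    (hA : A ⊆ X) (hm : m ≤ A.card) {w : α} (hw : w ∈ X) (hi : ∀ a ∈ A, a ≠ w ∧ c a w = i) :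
    i ∉ I := by
  intro hiI
  have h1 := h.degree_lt i hiI w hw
  have h2 : A ⊆ X.filter fun y => y ≠ w ∧ c w y = i := fun a ha =>
    Finset.mem_filter.2 ⟨hA ha, (hi a ha).1, (hc w a).trans (hi a ha).2⟩
  have h3 := Finset.card_le_card h2
  rw [colorDegree] at h1
  omega

/-- The induction step for a vertex set that splits into two sets `A`, `B` joined in a single
color. -/
lemma card_le_maxOrder_of_join (hc : ∀ x y, c x y = c y x) (hm : 3 ≤ m) (hX : BookFreeOn c m X)
    (hS : 3 ≤ S.card) (hI : IsAllowed c m X S I)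
    (ih : ∀ A ⊂ X, ∀ S I : Finset K, 1 ≤ S.card → IsAllowed c m A S I →
      (A.card : ℤ) ≤ maxOrder m S.card I.card)
    {A B : Finset α} (hAB : A ∪ B = X) (hdis : Disjoint A B) (hA : A.Nonempty) (hB : B.Nonempty)
    (hle : B.card ≤ A.card) (h : ∀ a ∈ A, ∀ b ∈ B, c a b = i) :
    (X.card : ℤ) ≤ maxOrder m S.card I.card := by
  have hcard : X.card = A.card + B.card := by rw [← hAB, Finset.card_union_of_disjoint hdis]
  have hAX : A ⊆ X := hAB ▸ Finset.subset_union_left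
  have hBX : B ⊆ X := hAB ▸ Finset.subset_union_right
  have hApos := hA.card_pos
  have hBpos := hB.card_pos
  have hA' : A ⊂ X := Finset.ssubset_iff_subset_ne.2 ⟨hAX, fun h => by rw [h] at hcard; omega⟩
  have hB' : B ⊂ X := Finset.ssubset_iff_subset_ne.2 ⟨hBX, fun h => by rw [h] at hcard; omega⟩
  have hj : ∀ a ∈ A, ∀ b ∈ B, a ≠ b ∧ c a b = i := fun a ha b hb =>
    ⟨fun hab => Finset.disjoint_left.1 hdis ha (hab ▸ hb), h a ha b hb⟩
  have hj' : ∀ b ∈ B, ∀ a ∈ A, b ≠ a ∧ c b a = i := fun b hb a ha =>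
    ⟨(hj a ha b hb).1.symm, (hc b a).trans (h a ha b hb)⟩
  obtain ⟨a, ha⟩ := hA
  obtain ⟨w, hw⟩ := hB
  have hiS : i ∈ S := (hj a ha w hw).2 ▸ hI.color_mem a (hAX ha) w (hBX hw) (hj a ha w hw).1
  -- If `i` is inadmissible in `A` only, then `A` has one more inadmissible color than `X`, which
  -- lowers the bound by the maximal size `m - 1` of `B`.
  by_cases hmA : m ≤ A.card
  · have hiI : i ∉ I := hI.notMem_of_forall_color_eq hc hAX hmA (hBX hw) fun a ha => hj a ha w hw
    by_cases hmB : m ≤ B.card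
    · have hSi : (S.erase i).card = S.card - 1 := Finset.card_erase_of_mem hiS
      have h1 := ih A hA' (S.erase i) I (by omega)
        ((hI.mono hAX).erase hiI (color_ne_of_join hX hAX hBX hmB hj))
      have h2 := ih B hB' (S.erase i) I (by omega)
        ((hI.mono hBX).erase hiI (color_ne_of_join hX hBX hAX hmA hj'))
      have h3 := two_mul_maxOrder_le (ℓ := I.card) hm (by omega : 2 ≤ (S.erase i).card)
      rw [show (S.erase i).card + 1 = S.card by omega] at h3
      rw [hcard]
      push_cast
      linarith
    · have h1 := ih A hA' S (insert i I) (by omega) ((hI.mono hAX).insert hiS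
        (colorDegree_lt_of_forall_color_eq hc hX hAX (hBX hw) fun a ha => hj a ha w hw))
      rw [Finset.card_insert_of_notMem hiI] at h1
      have h2 := maxOrder_add_one (m := m) (ℓ := I.card) (by omega : 2 ≤ S.card)
      omega
  · have h1 := bookRamseySum_le_maxOrder hm hS (Finset.card_le_card hI.subset)
    have h2 := six_mul_le_bookRamseySum hm
    omega

/-! ### Reduced partitions -/

/-- The part of the partition given by `f` that is represented by `p`. -/
def part (X : Finset α) (f : α → α) (p : α) : Finset α := X.filter fun x => f x = p

/-- The vertices outside the part of `p` that are joined to this part in color `i`. -/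
def partNeighbors (c : α → α → K) (X : Finset α) (f : α → α) (p : α) (i : K) : Finset α :=
  X.filter fun x => f x ≠ p ∧ c p x = i

lemma mem_part {f : α → α} {p x : α} : x ∈ part X f p ↔ x ∈ X ∧ f x = p := by
  simp [part]

lemma mem_partNeighbors {f : α → α} {p x : α} :
    x ∈ partNeighbors c X f p i ↔ x ∈ X ∧ f x ≠ p ∧ c p x = i := by
  simp [partNeighbors]

/-- The color `i` occurs on an edge inside `A`. -/
def OccursIn (c : α → α → K) (A : Finset α) (i : K) : Prop :=
  ∃ x ∈ A, ∃ y ∈ A, x ≠ y ∧ c x y = i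

/-- The setting for the main part of the argument: a Gallai partition of a vertex set without
monochromatic books, in which every part has neighbors in both colors `r` and `b`. -/
structure IsReducedPartition (c : α → α → K) (m : ℕ) (X : Finset α) (S I : Finset K)
    (f : α → α) (r b : K) : Prop where
  comm : ∀ x y, c x y = c y x
  bookFree : BookFreeOn c m X
  allowed : IsAllowed c m X S I
  gallai : IsGallaiPartition c X f r b
  ne : r ≠ b
  left_nonempty : ∀ p ∈ X.image f, (partNeighbors c X f p r).Nonempty
  right_nonempty : ∀ p ∈ X.image f, (partNeighbors c X f p b).Nonempty

lemma card_eq_sum_card_part (X : Finset α) (f : α → α) :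
    X.card = ∑ p ∈ X.image f, (part X f p).card :=
  Finset.card_eq_sum_card_image f X

namespace IsReducedPartition

variable {f : α → α} {r b : K} {p q w : α}

lemma symm (h : IsReducedPartition c m X S I f r b) : IsReducedPartition c m X S I f b r :=
  ⟨h.comm, h.bookFree, h.allowed, h.gallai.symm, h.ne.symm, h.right_nonempty, h.left_nonempty⟩

variable (h : IsReducedPartition c m X S I f r b)
include h

lemma mem_of_mem_image (hp : p ∈ X.image f) : p ∈ X ∧ f p = p := by
  obtain ⟨x, hx, rfl⟩ := Finset.mem_image.1 hp
  exact ⟨h.gallai.mem x hx, h.gallai.idem x hx⟩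

lemma color_eq {x y : α} (hp : p ∈ X.image f) (hx : x ∈ part X f p) (hy : y ∈ X)
    (hyp : f y ≠ p) : c x y = c p (f y) ∧ c p y = c p (f y) := by
  obtain ⟨hpX, hfp⟩ := h.mem_of_mem_image hp
  obtain ⟨hxX, hfx⟩ := mem_part.1 hx
  have h1 := h.gallai.color_eq x hxX y hy (by rw [hfx]; exact hyp.symm)
  have h2 := h.gallai.color_eq p hpX y hy (by rw [hfp]; exact hyp.symm)
  rw [hfx] at h1
  rw [hfp] at h2
  exact ⟨h1, h2⟩

lemma color_mem (hp : p ∈ X.image f) (hq : q ∈ X.image f) (hpq : p ≠ q) :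
    c p q = r ∨ c p q = b := by
  obtain ⟨hpX, hfp⟩ := h.mem_of_mem_image hp
  obtain ⟨hqX, hfq⟩ := h.mem_of_mem_image hq
  exact h.gallai.color_mem p hpX q hqX (by rwa [hfp, hfq])

lemma join_partNeighbors (hp : p ∈ X.image f) :
    ∀ x ∈ part X f p, ∀ y ∈ partNeighbors c X f p i, x ≠ y ∧ c x y = i := by
  intro x hx y hy
  obtain ⟨hyX, hyp, hi⟩ := mem_partNeighbors.1 hy
  have h1 := h.color_eq hp hx hyX hyp
  exact ⟨fun hxy => hyp (hxy ▸ (mem_part.1 hx).2), h1.1.trans (h1.2.symm.trans hi)⟩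

lemma card_le (hp : p ∈ X.image f) :
    X.card ≤ (part X f p).card + (partNeighbors c X f p r).card +
      (partNeighbors c X f p b).card := by
  have hsub : X ⊆ part X f p ∪ partNeighbors c X f p r ∪ partNeighbors c X f p b := by
    intro x hx
    simp only [Finset.mem_union, mem_part, mem_partNeighbors]
    by_cases hxp : f x = p
    · exact Or.inl (Or.inl ⟨hx, hxp⟩)
    · obtain ⟨hpX, hfp⟩ := h.mem_of_mem_image hp
      rcases h.gallai.color_mem p hpX x hx (by rw [hfp]; exact Ne.symm hxp) with hc | hc
      · exact Or.inl (Or.inr ⟨hx, hxp, hc⟩)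
      · exact Or.inr ⟨hx, hxp, hc⟩
  exact (Finset.card_le_card hsub).trans
    ((Finset.card_union_le _ _).trans (by gcongr; exact Finset.card_union_le _ _))

lemma part_subset_partNeighbors (hp : p ∈ X.image f) (hpq : p ≠ q) (hi : c p q = i) :
    part X f q ⊆ partNeighbors c X f p i := by
  intro y hy
  obtain ⟨hyX, hyq⟩ := mem_part.1 hy
  obtain ⟨hpX, hfp⟩ := h.mem_of_mem_image hp
  have h1 : f y ≠ p := by rw [hyq]; exact hpq.symm
  refine mem_partNeighbors.2 ⟨hyX, h1, ?_⟩
  rw [(h.color_eq hp (mem_part.2 ⟨hpX, hfp⟩) hyX h1).2, hyq, hi]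

lemma not_occursIn (hp : p ∈ X.image f) (hm : m ≤ (partNeighbors c X f p i).card) :
    ¬ OccursIn c (part X f p) i := by
  rintro ⟨x, hx, y, hy, hxy, hi⟩
  exact color_ne_of_join h.bookFree (Finset.filter_subset _ _) (Finset.filter_subset _ _) hm
    (h.join_partNeighbors hp) x hx y hy hxy hi

lemma not_occursIn_of_color_eq (hp : p ∈ X.image f) (hpq : p ≠ q)
    (hm : m ≤ (part X f q).card) (hi : c p q = i) : ¬ OccursIn c (part X f p) i :=
  h.not_occursIn hp (hm.trans (Finset.card_le_card (h.part_subset_partNeighbors hp hpq hi)))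

/-- A part of size at least `m` lies in no monochromatic triangle of parts: it would contain the
pages of a book whose spine joins the other two parts. -/
lemma not_triangle (hp : p ∈ X.image f) (hw : w ∈ X.image f) (hpw : p ≠ w)
    (hpq : p ≠ q) (hwq : w ≠ q) (hm : m ≤ (part X f q).card) (h1 : c p q = c p w)
    (h2 : c w q = c p w) : False := by
  have := h.bookFree p (h.mem_of_mem_image hp).1 w (h.mem_of_mem_image hw).1 hpw (part X f q)
    (Finset.filter_subset _ _) (fun z hz => by
      have hz1 := mem_partNeighbors.1 (h.part_subset_partNeighbors hp hpq h1 hz)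
      have hz2 := mem_partNeighbors.1 (h.part_subset_partNeighbors hw hwq h2 hz)
      refine ⟨fun e => hz1.2.1 ?_, fun e => hz2.2.1 ?_, hz1.2.2, hz2.2.2⟩
      · rw [e, (h.mem_of_mem_image hp).2]
      · rw [e, (h.mem_of_mem_image hw).2])
  omega

lemma left_notMem (hp : p ∈ X.image f) (hm : m ≤ (part X f p).card) : r ∉ I := by
  obtain ⟨w, hw⟩ := h.left_nonempty p hp
  exact h.allowed.notMem_of_forall_color_eq h.comm (Finset.filter_subset _ _) hm
    (mem_partNeighbors.1 hw).1 fun a ha => h.join_partNeighbors hp a ha w hw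

lemma left_mem (hp : p ∈ X.image f) : r ∈ S := by
  obtain ⟨w, hw⟩ := h.left_nonempty p hp
  obtain ⟨hpX, hfp⟩ := h.mem_of_mem_image hp
  obtain ⟨hwX, hwp, hr⟩ := mem_partNeighbors.1 hw
  exact hr ▸ h.allowed.color_mem p hpX w hwX fun e => hwp (e ▸ hfp)

lemma colorDegree_left_lt (hp : p ∈ X.image f) :
    ∀ x ∈ part X f p, colorDegree c (part X f p) r x < m := by
  obtain ⟨w, hw⟩ := h.left_nonempty p hp
  exact colorDegree_lt_of_forall_color_eq h.comm h.bookFree (Finset.filter_subset _ _)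
    (mem_partNeighbors.1 hw).1 fun a ha => h.join_partNeighbors hp a ha w hw

lemma part_ssubset (hp : p ∈ X.image f) : part X f p ⊂ X := by
  obtain ⟨w, hw⟩ := h.left_nonempty p hp
  obtain ⟨hwX, hwp, -⟩ := mem_partNeighbors.1 hw
  exact Finset.filter_ssubset.2 ⟨w, hwX, hwp⟩

section Induction

variable (ih : ∀ A ⊂ X, ∀ S I : Finset K, 1 ≤ S.card → IsAllowed c m A S I →
  (A.card : ℤ) ≤ maxOrder m S.card I.card)
include ih

/-- Both colors of the partition are inadmissible inside a part. -/
lemma card_part_le (hp : p ∈ X.image f) (hm : m ≤ (part X f p).card) :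
    ((part X f p).card : ℤ) ≤ maxOrder m S.card (I.card + 2) := by
  have hr := h.left_mem hp
  have hb := h.symm.left_mem hp
  have h1 := ih _ (h.part_ssubset hp) S (insert b (insert r I)) (Finset.card_pos.2 ⟨r, hr⟩)
    (((h.allowed.mono (Finset.filter_subset _ _)).insert hr (h.colorDegree_left_lt hp)).insert hb
      (h.symm.colorDegree_left_lt hp))
  rwa [Finset.card_insert_of_notMem (by
    simp [h.ne.symm, h.symm.left_notMem hp hm]), Finset.card_insert_of_notMem
    (h.left_notMem hp hm)] at h1

lemma card_part_le_of_not_occursIn_right (hp : p ∈ X.image f) (hm : m ≤ (part X f p).card)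
    (hb : ¬ OccursIn c (part X f p) b) :
    ((part X f p).card : ℤ) ≤ maxOrder m (S.card - 1) (I.card + 1) := by
  have hrI := h.left_notMem hp hm
  have hbI := h.symm.left_notMem hp hm
  have hr : r ∈ S.erase b := Finset.mem_erase.2 ⟨h.ne, h.left_mem hp⟩
  have h1 := ih _ (h.part_ssubset hp) (S.erase b) (insert r I) (Finset.card_pos.2 ⟨r, hr⟩)
    (((h.allowed.mono (Finset.filter_subset _ _)).erase hbI
      fun x hx y hy hxy e => hb ⟨x, hx, y, hy, hxy, e⟩).insert hr (h.colorDegree_left_lt hp))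
  rwa [Finset.card_insert_of_notMem hrI, Finset.card_erase_of_mem (h.symm.left_mem hp)] at h1

lemma card_part_le_of_not_occursIn (hS : 3 ≤ S.card) (hp : p ∈ X.image f)
    (hm : m ≤ (part X f p).card) (hr : ¬ OccursIn c (part X f p) r)
    (hb : ¬ OccursIn c (part X f p) b) :
    ((part X f p).card : ℤ) ≤ maxOrder m (S.card - 2) I.card := by
  have hb' : b ∈ S.erase r := Finset.mem_erase.2 ⟨h.ne.symm, h.symm.left_mem hp⟩
  have hcard : ((S.erase r).erase b).card = S.card - 2 := by
    rw [Finset.card_erase_of_mem hb', Finset.card_erase_of_mem (h.left_mem hp)]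
    omega
  have h1 := ih _ (h.part_ssubset hp) ((S.erase r).erase b) I (by omega)
    (((h.allowed.mono (Finset.filter_subset _ _)).erase (h.left_notMem hp hm)
      fun x hx y hy hxy e => hr ⟨x, hx, y, hy, hxy, e⟩).erase (h.symm.left_notMem hp hm)
      fun x hx y hy hxy e => hb ⟨x, hx, y, hy, hxy, e⟩)
  rwa [hcard] at h1

end Induction

/-- Parts of size at least `i` form a coloring without monochromatic books with `⌈m / i⌉` pages,
since such a book blows up to one with `m` pages. -/
lemma card_filter_lt {i : ℕ} (hi : 1 ≤ i) :
    ((X.image f).filter fun p => i ≤ (part X f p).card).card <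
      ramseyNumber (bookGraph ⌈(m : ℚ) / (i : ℚ)⌉₊) (bookGraph ⌈(m : ℚ) / (i : ℚ)⌉₊) := by
  refine card_lt_ramseyNumber h.comm (r := r) (b := b) ?_ fun p hp q hq hpq =>
    h.color_mem (Finset.mem_filter.1 hp).1 (Finset.mem_filter.1 hq).1 hpq
  intro p hp q hq hpq T hT hTc
  have hp := (Finset.mem_filter.1 hp).1
  have hq := (Finset.mem_filter.1 hq).1
  by_contra! hle
  have hmT : m ≤ T.card * i := by
    have h0 : (0 : ℚ) < i := by exact_mod_cast hi
    have h1 := Nat.ceil_le.1 hle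
    rw [div_le_iff₀ h0] at h1
    exact_mod_cast h1
  have hlow : T.card * i ≤ (X.filter fun x => f x ∈ T).card := by
    have hmaps : ∀ x ∈ X.filter fun x => f x ∈ T, f x ∈ T := fun x hx => (Finset.mem_filter.1 hx).2
    rw [Finset.card_eq_sum_card_fiberwise hmaps, ← smul_eq_mul]
    refine Finset.card_nsmul_le_sum _ _ _ fun t ht => ?_
    refine (Finset.mem_filter.1 (hT ht)).2.trans (Finset.card_le_card fun x hx => ?_)
    obtain ⟨hxX, hxt⟩ := mem_part.1 hx
    simp [hxX, hxt, ht]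
  have := h.bookFree p (h.mem_of_mem_image hp).1 q (h.mem_of_mem_image hq).1 hpq
    (X.filter fun x => f x ∈ T) (Finset.filter_subset _ _) (fun z hz => by
      obtain ⟨hzX, hzT⟩ := Finset.mem_filter.1 hz
      obtain ⟨h1, h2, h3, h4⟩ := hTc _ hzT
      have hzp : z ∈ part X f (f z) := mem_part.2 ⟨hzX, rfl⟩
      exact ⟨fun e => h1 (e ▸ (h.mem_of_mem_image hp).2),
        fun e => h2 (e ▸ (h.mem_of_mem_image hq).2),
        (mem_partNeighbors.1 (h.part_subset_partNeighbors hp (Ne.symm h1) h3 hzp)).2.2,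
        (mem_partNeighbors.1 (h.part_subset_partNeighbors hq (Ne.symm h2) h4 hzp)).2.2⟩)
  omega

/-- Counting the parts of size at least `i` for `1 ≤ i ≤ m - 1`. -/
lemma sum_min_le (hm : 1 ≤ m) :
    ∑ p ∈ X.image f, (min (part X f p).card (m - 1) : ℕ) ≤ bookRamseySum m := by
  have h1 : ∑ p ∈ X.image f, min (part X f p).card (m - 1) =
      ∑ i ∈ Finset.Icc 1 (m - 1), ((X.image f).filter fun p => i ≤ (part X f p).card).card := by
    refine Eq.trans ?_ (Finset.sum_card_bipartiteAbove_eq_sum_card_bipartiteBelow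
      fun i p => i ≤ (part X f p).card).symm
    refine Finset.sum_congr rfl fun p _ => ?_
    have : (Finset.Icc 1 (m - 1)).filter (fun i => i ≤ (part X f p).card) =
        Finset.Icc 1 (min (part X f p).card (m - 1)) := by
      ext; simp; omega
    simp [Finset.bipartiteBelow, this]
  rw [h1, bookRamseySum]
  push_cast
  refine Finset.sum_le_sum fun i hi => ?_
  have := h.card_filter_lt (Finset.mem_Icc.1 hi).1
  omega

/-- Truncating all part sizes at `m - 1` leaves at most `bookRamseySum m` vertices. -/
lemma card_le_bookRamseySum_add (hm : 1 ≤ m) :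
    (X.card : ℤ) ≤ bookRamseySum m +
      ∑ p ∈ (X.image f).filter (fun p => m ≤ (part X f p).card),
        (((part X f p).card : ℤ) - (m - 1)) := by
  have h1 := h.sum_min_le hm
  rw [card_eq_sum_card_part X f, Finset.sum_filter]
  push_cast at h1 ⊢
  refine le_trans ?_ (add_le_add_left h1 _)
  rw [← Finset.sum_add_distrib]
  refine Finset.sum_le_sum fun p _ => ?_
  split_ifs <;> omega

end IsReducedPartition

end Inadmissible

/-! ### The induction step for reduced partitions -/

variable [DecidableEq α] [DecidableEq K]

omit [DecidableEq K] in
/-- The Ramsey number `R(3, 3)` is at most `6`. -/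
lemma exists_monochromatic_triangle {c : α → α → K} {Q : Finset α}
    (hQ : 6 ≤ Q.card) {r b : K} (hrb : ∀ x ∈ Q, ∀ y ∈ Q, x ≠ y → c x y = r ∨ c x y = b) :
    ∃ x ∈ Q, ∃ y ∈ Q, ∃ z ∈ Q, x ≠ y ∧ x ≠ z ∧ y ≠ z ∧ c x z = c x y ∧ c y z = c x y := by
  classical
  obtain ⟨v, hv⟩ : Q.Nonempty := Finset.card_pos.1 (by omega)
  have main (r b : K) (hrb : ∀ x ∈ Q, ∀ y ∈ Q, x ≠ y → c x y = r ∨ c x y = b)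
      (hlt : 2 < ((Q.erase v).filter fun x => c v x = r).card) :
      ∃ x ∈ Q, ∃ y ∈ Q, ∃ z ∈ Q, x ≠ y ∧ x ≠ z ∧ y ≠ z ∧ c x z = c x y ∧ c y z = c x y := by
    obtain ⟨x, hx, y, hy, z, hz, hxy, hxz, hyz⟩ := Finset.two_lt_card.1 hlt
    simp only [Finset.mem_filter, Finset.mem_erase] at hx hy hz
    obtain ⟨⟨hxv, hxQ⟩, hx⟩ := hx
    obtain ⟨⟨hyv, hyQ⟩, hy⟩ := hy
    obtain ⟨⟨hzv, hzQ⟩, hz⟩ := hz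
    by_cases h1 : c x y = r
    · exact ⟨v, hv, x, hxQ, y, hyQ, hxv.symm, hyv.symm, hxy, by rw [hx, hy], by rw [hx, h1]⟩
    by_cases h2 : c x z = r
    · exact ⟨v, hv, x, hxQ, z, hzQ, hxv.symm, hzv.symm, hxz, by rw [hx, hz], by rw [hx, h2]⟩
    by_cases h3 : c y z = r
    · exact ⟨v, hv, y, hyQ, z, hzQ, hyv.symm, hzv.symm, hyz, by rw [hy, hz], by rw [hy, h3]⟩
    have h1 := (hrb x hxQ y hyQ hxy).resolve_left h1
    have h2 := (hrb x hxQ z hzQ hxz).resolve_left h2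
    have h3 := (hrb y hyQ z hzQ hyz).resolve_left h3
    exact ⟨x, hxQ, y, hyQ, z, hzQ, hxy, hxz, hyz, by rw [h1, h2], by rw [h1, h3]⟩
  have hcard : (Q.erase v).card ≤ ((Q.erase v).filter fun x => c v x = r).card +
      ((Q.erase v).filter fun x => c v x = b).card := by
    refine (Finset.card_le_card fun x hx => ?_).trans (Finset.card_union_le _ _)
    obtain ⟨hxv, hxQ⟩ := Finset.mem_erase.1 hx
    rcases hrb v hv x hxQ hxv.symm with h | h <;> simp [hxv, hxQ, h]
  rw [Finset.card_erase_of_mem hv] at hcard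
  rcases (by omega : 2 < ((Q.erase v).filter fun x => c v x = r).card ∨
    2 < ((Q.erase v).filter fun x => c v x = b).card) with h | h
  · exact main r b hrb h
  · exact main b r (fun x hx y hy hxy => (hrb x hx y hy hxy).symm) h

/-- The representatives of the parts with at least `m` vertices. -/
def largeParts (m : ℕ) (X : Finset α) (f : α → α) : Finset α :=
  (X.image f).filter fun p => m ≤ (part X f p).card

lemma mem_largeParts {m : ℕ} {X : Finset α} {f : α → α} {p : α} :
    p ∈ largeParts m X f ↔ p ∈ X.image f ∧ m ≤ (part X f p).card := by
  simp [largeParts]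

namespace IsReducedPartition

variable {c : α → α → K} {m : ℕ} {X : Finset α} {S I : Finset K} {f : α → α} {r b : K} {p q : α}
variable (h : IsReducedPartition c m X S I f r b)
include h

lemma card_le_add_pred_add_pred (hm : 1 ≤ m) (hp : p ∈ X.image f)
    (hr : OccursIn c (part X f p) r) (hb : OccursIn c (part X f p) b) :
    X.card ≤ (part X f p).card + (m - 1) + (m - 1) := by
  have h1 := h.card_le hp
  have h2 : ¬ m ≤ (partNeighbors c X f p r).card := fun h' => h.not_occursIn hp h' hr
  have h3 : ¬ m ≤ (partNeighbors c X f p b).card := fun h' => h.not_occursIn hp h' hb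
  omega

/-- If `r` occurs in two large parts, then every other vertex is joined in color `r` to one of
the two, because a common neighbor in color `b` would create a monochromatic triangle of parts. -/
lemma card_le_of_occursIn_two (hm : 1 ≤ m) (hp : p ∈ largeParts m X f)
    (hq : q ∈ largeParts m X f) (hpq : p ≠ q) (hrp : OccursIn c (part X f p) r)
    (hrq : OccursIn c (part X f q) r) :
    X.card ≤ (part X f p).card + (part X f q).card + (m - 1) + (m - 1) ∧
      ¬ OccursIn c (part X f p) b ∧ ¬ OccursIn c (part X f q) b := by
  rw [mem_largeParts] at hp hq
  have hcol : c p q = b := (h.color_mem hp.1 hq.1 hpq).resolve_left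
    fun e => h.not_occursIn_of_color_eq hp.1 hpq hq.2 e hrp
  refine ⟨?_, h.not_occursIn_of_color_eq hp.1 hpq hq.2 hcol,
    h.not_occursIn_of_color_eq hq.1 hpq.symm hp.2 ((h.comm q p).trans hcol)⟩
  have h2 : ¬ m ≤ (partNeighbors c X f p r).card := fun h' => h.not_occursIn hp.1 h' hrp
  have h3 : ¬ m ≤ (partNeighbors c X f q r).card := fun h' => h.not_occursIn hq.1 h' hrq
  have hsub : X ⊆ part X f p ∪ part X f q ∪ partNeighbors c X f p r ∪
      partNeighbors c X f q r := by
    intro x hx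
    simp only [Finset.mem_union, mem_part, mem_partNeighbors, hx, true_and]
    by_contra! hcon
    obtain ⟨⟨⟨hxp, hxq⟩, hxp'⟩, hxq'⟩ := hcon
    have hpX := h.mem_of_mem_image hp.1
    have hqX := h.mem_of_mem_image hq.1
    have h4 := (h.gallai.color_mem p hpX.1 x hx (by rw [hpX.2]; exact Ne.symm hxp)).resolve_left
      (hxp' hxp)
    have h5 := (h.gallai.color_mem q hqX.1 x hx (by rw [hqX.2]; exact Ne.symm hxq)).resolve_left
      (hxq' hxq)
    rw [(h.color_eq hp.1 (mem_part.2 hpX) hx hxp).2] at h4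
    rw [(h.color_eq hq.1 (mem_part.2 hqX) hx hxq).2] at h5
    refine h.not_triangle (Finset.mem_image_of_mem f hx) hp.1 hxp hxq hpq hq.2 ?_ ?_
    · rw [h.comm, h5, h.comm, h4]
    · rw [hcol, h.comm, h4]
  have h6 := (Finset.card_le_card hsub).trans ((Finset.card_union_le _ _).trans
    (Nat.add_le_add_right ((Finset.card_union_le _ _).trans
      (Nat.add_le_add_right (Finset.card_union_le _ _) _)) _))
  omega

/-- If `r` occurs in a large part, then all other large parts are joined to it in color `b`, hence
to one another in color `r`, so that there are at most two of them. -/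
lemma card_largeParts_erase_le (hp : p ∈ largeParts m X f) (hrp : OccursIn c (part X f p) r) :
    ((largeParts m X f).erase p).card ≤ 2 := by
  by_contra! hlt
  obtain ⟨x, hx, y, hy, z, hz, hxy, hxz, hyz⟩ := Finset.two_lt_card.1 hlt
  simp only [Finset.mem_erase, mem_largeParts] at hx hy hz
  rw [mem_largeParts] at hp
  have hb {q} (hqp : q ≠ p) (hq : q ∈ X.image f) (hqm : m ≤ (part X f q).card) : c p q = b :=
    (h.color_mem hp.1 hq hqp.symm).resolve_left
      fun e => h.not_occursIn_of_color_eq hp.1 hqp.symm hqm e hrp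
  have hx' := hb hx.1 hx.2.1 hx.2.2
  have hy' := hb hy.1 hy.2.1 hy.2.2
  have hz' := hb hz.1 hz.2.1 hz.2.2
  have hr {u v} (hup : u ≠ p) (hvp : v ≠ p) (hu : u ∈ X.image f) (hv : v ∈ X.image f)
      (hvm : m ≤ (part X f v).card) (huv : u ≠ v) (hcu : c p u = b) (hcv : c p v = b) :
      c u v = r :=
    (h.color_mem hu hv huv).resolve_right fun e =>
      h.not_triangle hp.1 hu hup.symm hvp.symm huv hvm (hcv.trans hcu.symm) (e.trans hcu.symm)
  have h1 := hr hx.1 hy.1 hx.2.1 hy.2.1 hy.2.2 hxy hx' hy'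
  have h2 := hr hx.1 hz.1 hx.2.1 hz.2.1 hz.2.2 hxz hx' hz'
  have h3 := hr hy.1 hz.1 hy.2.1 hz.2.1 hz.2.2 hyz hy' hz'
  exact h.not_triangle hx.2.1 hy.2.1 hxy hxz hyz hz.2.2 (h2.trans h1.symm) (h3.trans h1.symm)

/-- Six parts, all but one of which are large, would contain a monochromatic triangle of parts. -/
lemma card_insert_largeParts_le (hp : p ∈ X.image f) : (insert p (largeParts m X f)).card ≤ 5 := by
  by_contra! hlt
  have hmem {x} (hx : x ∈ insert p (largeParts m X f)) : x ∈ X.image f := by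
    rcases Finset.mem_insert.1 hx with rfl | hx
    · exact hp
    · exact (mem_largeParts.1 hx).1
  obtain ⟨x, hx, y, hy, z, hz, hxy, hxz, hyz, h1, h2⟩ :=
    exists_monochromatic_triangle (by omega) fun x hx y hy hxy =>
      h.color_mem (hmem hx) (hmem hy) hxy
  by_cases hzp : z = p
  · have hym := (mem_largeParts.1 ((Finset.mem_insert.1 hy).resolve_left fun e =>
      hyz (e.trans hzp.symm))).2
    exact h.not_triangle (hmem hx) (hmem hz) hxz hxy hyz.symm hym h1.symm
      ((h.comm z y).trans (h2.trans h1.symm))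
  · have hzm := (mem_largeParts.1 ((Finset.mem_insert.1 hz).resolve_left hzp)).2
    exact h.not_triangle (hmem hx) (hmem hy) hxy hxz hyz hzm h1 h2

lemma card_inadmissible_add_two_le (hp : p ∈ largeParts m X f) : I.card + 2 ≤ S.card := by
  rw [mem_largeParts] at hp
  have hr := h.left_notMem hp.1 hp.2
  have hb := h.symm.left_notMem hp.1 hp.2
  have hsub : insert b (insert r I) ⊆ S := Finset.insert_subset (h.symm.left_mem hp.1)
    (Finset.insert_subset (h.left_mem hp.1) h.allowed.subset)
  have := Finset.card_le_card hsub
  rwa [Finset.card_insert_of_notMem (by simp [h.ne.symm, hb]), Finset.card_insert_of_notMem hr]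
    at this

section Induction

variable (ih : ∀ A ⊂ X, ∀ S I : Finset K, 1 ≤ S.card → IsAllowed c m A S I →
  (A.card : ℤ) ≤ maxOrder m S.card I.card)
include ih

/-- The case that `r` occurs in some large part. -/
lemma card_le_maxOrder_of_occursIn (hm : 3 ≤ m) (hS : 3 ≤ S.card) (hp : p ∈ largeParts m X f)
    (hrp : OccursIn c (part X f p) r) : (X.card : ℤ) ≤ maxOrder m S.card I.card := by
  have hI := h.card_inadmissible_add_two_le hp
  obtain ⟨k, hk⟩ : ∃ k, S.card = k + 2 := ⟨S.card - 2, by omega⟩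
  have hp' := mem_largeParts.1 hp
  by_cases hbp : OccursIn c (part X f p) b
  · -- The two additional inadmissible colors pay for all vertices outside the part of `p`.
    have h1 := h.card_le_add_pred_add_pred (by omega) hp'.1 hrp hbp
    have h2 := h.card_part_le ih hp'.1 hp'.2
    have h3 := maxOrder_add_one (m := m) (ℓ := I.card) (by omega : 2 ≤ S.card)
    have h4 := maxOrder_add_one (m := m) (ℓ := I.card + 1) (by omega : 2 ≤ S.card)
    rw [show I.card + 1 + 1 = I.card + 2 from rfl] at h4
    omega
  have hap := h.card_part_le_of_not_occursIn_right ih hp'.1 hp'.2 hbp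
  by_cases hq : ∃ q ∈ largeParts m X f, p ≠ q ∧ OccursIn c (part X f q) r
  · -- One additional inadmissible color in each of two parts pays for the other vertices.
    obtain ⟨q, hq, hpq, hrq⟩ := hq
    obtain ⟨h1, -, hbq⟩ := h.card_le_of_occursIn_two (by omega) hp hq hpq hrp hrq
    have hq' := mem_largeParts.1 hq
    have haq := h.card_part_le_of_not_occursIn_right ih hq'.1 hq'.2 hbq
    have h2 := maxOrder_add_one (m := m) (ℓ := I.card) (by omega : 2 ≤ S.card - 1)
    have h3 := two_mul_maxOrder_le (ℓ := I.card) hm (by omega : 2 ≤ S.card - 1)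
    rw [show S.card - 1 + 1 = S.card by omega] at h3
    omega
  -- The color `b` does not occur in another large part either: such a part is joined to that of `p`
  -- in color `b`, as `r` occurs in the latter.
  push Not at hq
  have hother (q) (hqL : q ∈ (largeParts m X f).erase p) :
      ((part X f q).card : ℤ) - (m - 1) ≤ maxOrder m k I.card - (m - 1) := by
    obtain ⟨hqp, hqL⟩ := Finset.mem_erase.1 hqL
    have hq' := mem_largeParts.1 hqL
    have hcol : c q p = b := (h.color_mem hq'.1 hp'.1 hqp).resolve_left fun e =>
      h.not_occursIn_of_color_eq hp'.1 hqp.symm hq'.2 ((h.comm p q).trans e) hrp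
    have := h.card_part_le_of_not_occursIn ih hS hq'.1 hq'.2 (hq q hqL hqp.symm)
      (h.not_occursIn_of_color_eq hq'.1 hqp hp'.2 hcol)
    rw [hk, Nat.add_sub_cancel] at this
    linarith
  have hsum := Finset.sum_le_card_nsmul _ _ _ hother
  have hnonneg := le_maxOrder (ℓ := I.card) hm (by omega : 1 ≤ k) (by omega)
  have hcard : ((((largeParts m X f).erase p).card : ℕ) : ℤ) * (maxOrder m k I.card - (m - 1)) ≤
      2 * (maxOrder m k I.card - (m - 1)) :=
    mul_le_mul_of_nonneg_right (by exact_mod_cast h.card_largeParts_erase_le hp hrp) (by linarith)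
  have htotal := h.card_le_bookRamseySum_add (by omega)
  have hsplit := Finset.add_sum_erase (largeParts m X f)
    (fun q => ((part X f q).card : ℤ) - (m - 1)) hp
  have hnum := bookRamseySum_add_maxOrder_add_two_mul_le hm (by omega : 1 ≤ k)
    (by omega : I.card ≤ k)
  rw [hk, show k + 2 - 1 = k + 1 by omega] at hap
  rw [nsmul_eq_mul] at hsum
  rw [hk]
  rw [largeParts] at hsplit hsum hcard
  linarith

/-- The case that neither `r` nor `b` occurs in a large part. -/
lemma card_le_maxOrder_of_not_occursIn (hm : 3 ≤ m) (hS : 3 ≤ S.card)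
    (hno : ∀ p ∈ largeParts m X f, ¬ OccursIn c (part X f p) r ∧ ¬ OccursIn c (part X f p) b) :
    (X.card : ℤ) ≤ maxOrder m S.card I.card := by
  have htotal := h.card_le_bookRamseySum_add (by omega)
  rcases (largeParts m X f).eq_empty_or_nonempty with hL | ⟨p, hp⟩
  · rw [largeParts] at hL
    rw [hL, Finset.sum_empty, add_zero] at htotal
    exact htotal.trans (bookRamseySum_le_maxOrder hm hS (Finset.card_le_card h.allowed.subset))
  have hI := h.card_inadmissible_add_two_le hp
  obtain ⟨k, hk⟩ : ∃ k, S.card = k + 2 := ⟨S.card - 2, by omega⟩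
  have hpart (q) (hqL : q ∈ largeParts m X f) : ((part X f q).card : ℤ) ≤ maxOrder m k I.card := by
    have hq' := mem_largeParts.1 hqL
    have := h.card_part_le_of_not_occursIn ih hS hq'.1 hq'.2 (hno q hqL).1 (hno q hqL).2
    rwa [hk, Nat.add_sub_cancel] at this
  rw [hk]
  by_cases h4 : (largeParts m X f).card ≤ 4
  · have hsum := Finset.sum_le_card_nsmul (largeParts m X f)
      (fun q => ((part X f q).card : ℤ) - (m - 1)) (maxOrder m k I.card - (m - 1))
      fun q hq => by linarith [hpart q hq]
    have hnonneg := le_maxOrder (ℓ := I.card) hm (by omega : 1 ≤ k) (by omega)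
    have hcard : (((largeParts m X f).card : ℕ) : ℤ) * (maxOrder m k I.card - (m - 1)) ≤
        4 * (maxOrder m k I.card - (m - 1)) :=
      mul_le_mul_of_nonneg_right (by exact_mod_cast h4) (by linarith)
    have hnum := bookRamseySum_add_four_mul_le hm (by omega : 1 ≤ k) (by omega : I.card ≤ k)
    rw [nsmul_eq_mul] at hsum
    rw [largeParts] at hsum hcard
    linarith
  · -- With five large parts there is no room for a further part.
    have hall : X.image f ⊆ largeParts m X f := by
      intro w hw
      by_contra hwL
      have := h.card_insert_largeParts_le (m := m) hw
      rw [Finset.card_insert_of_notMem hwL] at this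
      omega
    have h5 := h.card_insert_largeParts_le (m := m) (mem_largeParts.1 hp).1
    rw [Finset.insert_eq_of_mem hp] at h5
    have hsum := Finset.sum_le_card_nsmul (X.image f) (fun q => ((part X f q).card : ℤ))
      (maxOrder m k I.card) fun q hq => hpart q (hall hq)
    have hnonneg := le_maxOrder (ℓ := I.card) hm (by omega : 1 ≤ k) (by omega)
    have hcard : (((X.image f).card : ℕ) : ℤ) * maxOrder m k I.card ≤ 5 * maxOrder m k I.card :=
      mul_le_mul_of_nonneg_right (by exact_mod_cast (Finset.card_le_card hall).trans h5) (by omega)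
    have hnum := five_mul_maxOrder_le hm (by omega : 1 ≤ k) (by omega : I.card ≤ k)
    rw [nsmul_eq_mul] at hsum
    rw [card_eq_sum_card_part X f]
    push_cast
    linarith

lemma card_le_maxOrder (hm : 3 ≤ m) (hS : 3 ≤ S.card) :
    (X.card : ℤ) ≤ maxOrder m S.card I.card := by
  by_cases hr : ∃ p ∈ largeParts m X f, OccursIn c (part X f p) r
  · obtain ⟨p, hp, hrp⟩ := hr
    exact h.card_le_maxOrder_of_occursIn ih hm hS hp hrp
  by_cases hb : ∃ p ∈ largeParts m X f, OccursIn c (part X f p) b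
  · obtain ⟨p, hp, hbp⟩ := hb
    exact h.symm.card_le_maxOrder_of_occursIn ih hm hS hp hbp
  push Not at hr hb
  exact h.card_le_maxOrder_of_not_occursIn ih hm hS fun p hp => ⟨hr p hp, hb p hp⟩

end Induction

end IsReducedPartition

/-! ### The upper bound -/

/-- A coloring with a single color and no monochromatic book. -/
lemma card_le_maxOrder_of_card_eq_one {c : α → α → K} {m : ℕ} (hm : 3 ≤ m) {X : Finset α}
    (hX : BookFreeOn c m X) {S I : Finset K} (hS : S.card = 1) (hI : IsAllowed c m X S I) :
    (X.card : ℤ) ≤ maxOrder m S.card I.card := by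
  obtain ⟨i, rfl⟩ := Finset.card_eq_one.1 hS
  have hi : ∀ x ∈ X, ∀ y ∈ X, x ≠ y → c x y = i := fun x hx y hy hxy => by
    simpa using hI.color_mem x hx y hy hxy
  rw [hS, maxOrder_one]
  rcases Finset.subset_singleton_iff.1 hI.subset with rfl | rfl
  · by_contra! hlt
    rw [Finset.card_empty] at hlt
    obtain ⟨x, hx, y, hy, hxy⟩ := Finset.one_lt_card.1 (by omega : 1 < X.card)
    have h1 := hX x hx y hy hxy ((X.erase x).erase y)
      ((Finset.erase_subset _ _).trans (Finset.erase_subset _ _)) fun z hz => by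
        simp only [Finset.mem_erase] at hz
        exact ⟨hz.2.1, hz.1, (hi x hx z hz.2.2 hz.2.1.symm).trans (hi x hx y hy hxy).symm,
          (hi y hy z hz.2.2 (Ne.symm hz.1)).trans (hi x hx y hy hxy).symm⟩
    rw [Finset.card_erase_of_mem (Finset.mem_erase.2 ⟨hxy.symm, hy⟩),
      Finset.card_erase_of_mem hx] at h1
    omega
  · rcases X.eq_empty_or_nonempty with rfl | ⟨x, hx⟩
    · simp
    · have h1 := hI.degree_lt i (by simp) x hx
      have h2 : X.filter (fun y => y ≠ x ∧ c x y = i) = X.erase x := by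
        ext y
        simp only [Finset.mem_filter, Finset.mem_erase]
        exact ⟨fun h => ⟨h.2.1, h.1⟩, fun h => ⟨h.2, h.1, hi x hx y h.2 h.1.symm⟩⟩
      rw [colorDegree, h2, Finset.card_erase_of_mem hx] at h1
      simp only [Finset.card_singleton]
      omega

/-- The bound on the order of a coloring without rainbow triangles and monochromatic books, for
vertex subsets and sets of colors, by induction on the number of vertices. -/
theorem card_le_maxOrder {c : α → α → K} (hc : ∀ x y, c x y = c y x) (hG : NoRainbow c) {m : ℕ}
    (hm : 3 ≤ m) (X : Finset α) (hX : BookFreeOn c m X) (S I : Finset K) (hS : 1 ≤ S.card)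
    (hI : IsAllowed c m X S I) : (X.card : ℤ) ≤ maxOrder m S.card I.card := by
  induction X using Finset.strongInduction generalizing S I with
  | H X ih =>
    have hIS := Finset.card_le_card hI.subset
    have ih' : ∀ A ⊂ X, ∀ S I : Finset K, 1 ≤ S.card → IsAllowed c m A S I →
        (A.card : ℤ) ≤ maxOrder m S.card I.card :=
      fun A hA S I hS hI => ih A hA (hX.mono hA.subset) S I hS hI
    rcases (by omega : S.card = 1 ∨ S.card = 2 ∨ 3 ≤ S.card) with h1 | h2 | h3
    · exact card_le_maxOrder_of_card_eq_one hm hX h1 hI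
    · obtain ⟨r, b, -, rfl⟩ := Finset.card_eq_two.1 h2
      have h := card_lt_ramseyNumber hc hX (r := r) (b := b) fun x hx y hy hxy => by
        simpa using hI.color_mem x hx y hy hxy
      have h' := ramseyNumber_le_maxOrder hm (h2 ▸ hIS)
      rw [h2]
      omega
    by_cases hcard : X.card ≤ 1
    · have := bookRamseySum_le_maxOrder hm h3 hIS
      have := six_mul_le_bookRamseySum hm
      omega
    obtain ⟨f, r, b, hf, x, hx, y, hy, hxy⟩ :=
      exists_isGallaiPartition hc hG (by omega) hI.color_mem
    have hrep {p} (hp : p ∈ X.image f) : p ∈ X ∧ f p = p := by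
      obtain ⟨x, hx, rfl⟩ := Finset.mem_image.1 hp
      exact ⟨hf.mem x hx, hf.idem x hx⟩
    by_cases hone : ∃ p ∈ X.image f, ∃ i, ∀ z ∈ X, f z ≠ p → c p z = i
    · obtain ⟨p, hp, i, hi⟩ := hone
      obtain ⟨hpX, hfp⟩ := hrep hp
      set A := X.filter fun z => f z = p
      set B := X.filter fun z => ¬ f z = p
      have hAB : A ∪ B = X := Finset.filter_union_filter_not_eq _ _
      have hdis : Disjoint A B := Finset.disjoint_filter_filter_not _ _ _
      have hA : A.Nonempty := ⟨p, Finset.mem_filter.2 ⟨hpX, hfp⟩⟩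
      have hB : B.Nonempty := by
        by_cases hxp : f x = p
        · exact ⟨y, Finset.mem_filter.2 ⟨hy, fun e => hxy (hxp.trans e.symm)⟩⟩
        · exact ⟨x, Finset.mem_filter.2 ⟨hx, hxp⟩⟩
      have hcol : ∀ a ∈ A, ∀ z ∈ B, c a z = i := by
        intro a ha z hz
        obtain ⟨haX, hap⟩ := Finset.mem_filter.1 ha
        obtain ⟨hzX, hzp⟩ := Finset.mem_filter.1 hz
        have h1 := hf.color_eq a haX z hzX (by rw [hap]; exact Ne.symm hzp)
        have h2 := hf.color_eq p hpX z hzX (by rw [hfp]; exact Ne.symm hzp)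
        rw [h1, hap, ← hi z hzX hzp, h2, hfp]
      rcases le_total B.card A.card with hle | hle
      · exact card_le_maxOrder_of_join hc hm hX h3 hI ih' hAB hdis hA hB hle hcol
      · exact card_le_maxOrder_of_join hc hm hX h3 hI ih' ((Finset.union_comm _ _).trans hAB)
          hdis.symm hB hA hle fun z hz a ha => (hc z a).trans (hcol a ha z hz)
    · push Not at hone
      have hnbr (p) (hp : p ∈ X.image f) (i) : ∃ z ∈ X, f z ≠ p ∧ c p z ≠ i ∧
          (c p z = r ∨ c p z = b) := by
        obtain ⟨hpX, hfp⟩ := hrep hp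
        obtain ⟨z, hz, hzp, hi⟩ := hone p hp i
        exact ⟨z, hz, hzp, hi, hf.color_mem p hpX z hz (by rw [hfp]; exact hzp.symm)⟩
      have hred : IsReducedPartition c m X S I f r b := by
        refine ⟨hc, hX, hI, hf, ?_, fun p hp => ?_, fun p hp => ?_⟩
        · rintro rfl
          obtain ⟨z, -, -, hne, h | h⟩ := hnbr _ (Finset.mem_image_of_mem f hx) r <;>
            exact hne h
        · obtain ⟨z, hz, hzp, hne, h⟩ := hnbr p hp b
          exact ⟨z, mem_partNeighbors.2 ⟨hz, hzp, h.resolve_right hne⟩⟩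
        · obtain ⟨z, hz, hzp, hne, h⟩ := hnbr p hp r
          exact ⟨z, mem_partNeighbors.2 ⟨hz, hzp, h.resolve_left hne⟩⟩
      exact hred.card_le_maxOrder ih' hm h3

lemma maxOrder_nonneg {m k ℓ : ℕ} (hm : 3 ≤ m) (hk : 1 ≤ k) (hℓ : ℓ ≤ k) :
    0 ≤ maxOrder m k ℓ := by
  have := le_maxOrder hm hk hℓ
  omega

lemma gallaiRamseyProperty_of_maxOrder_lt {k ℓ m n : ℕ} (hk : 1 ≤ k) (hm : 3 ≤ m)
    (hn : maxOrder m k ℓ < n) : GallaiRamseyProperty k ℓ m (bookGraph m) n := by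
  classical
  intro C hC
  by_contra! hcon
  obtain ⟨hrainbow, hmono⟩ := hcon
  have : NeZero k := ⟨by omega⟩
  -- The value `0` on the diagonal is never used.
  let c : Fin n → Fin n → Fin k := fun x y => if h : x ≠ y then C.get x y h else 0
  have hget {x y : Fin n} (h : x ≠ y) : c x y = C.get x y h := dif_pos h
  have hc (x y) : c x y = c y x := by
    by_cases h : x = y
    · rw [h]
    · rw [hget h, hget (Ne.symm h), SimpleGraph.EdgeLabeling.get_comm]
  have hG : NoRainbow c := by
    intro x y z hxy hyz hxz
    by_contra! h
    refine hrainbow ⟨x, y, z, hxy, hyz, hxz, ?_⟩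
    simpa only [← hget] using h
  have hX : BookFreeOn c m Finset.univ := by
    intro x _ y _ hxy T _ hT
    by_contra! hle
    refine hmono ⟨c x y, bookGraph_isContained_iff.2 ⟨x, y, ?_, T, hle, fun z hz => ?_⟩⟩
    · exact (SimpleGraph.TopEdgeLabeling.labelGraph_adj x y).2 ⟨hxy, (hget hxy).symm⟩
    · obtain ⟨h1, h2, h3, h4⟩ := hT z hz
      exact ⟨(SimpleGraph.TopEdgeLabeling.labelGraph_adj x z).2
          ⟨h1.symm, (hget h1.symm).symm.trans h3⟩,
        (SimpleGraph.TopEdgeLabeling.labelGraph_adj y z).2 ⟨h2.symm, (hget h2.symm).symm.trans h4⟩⟩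
  obtain ⟨I, hIsub, hIcard⟩ := Set.exists_subset_card_eq hC
  have hI : IsAllowed c m Finset.univ Finset.univ I.toFinset := by
    refine ⟨fun _ _ _ _ _ => Finset.mem_univ _, Finset.subset_univ _, fun i hi x _ => ?_⟩
    have h1 : (C.labelGraph i).maxDegree < m := not_le.1 (hIsub (Set.mem_toFinset.1 hi))
    refine lt_of_eq_of_lt ?_ ((SimpleGraph.degree_le_maxDegree _ x).trans_lt h1)
    rw [colorDegree, ← SimpleGraph.card_neighborFinset_eq_degree]
    congr 1
    ext y
    simp only [Finset.mem_filter, Finset.mem_univ, true_and, SimpleGraph.mem_neighborFinset,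
      SimpleGraph.TopEdgeLabeling.labelGraph_adj]
    constructor
    · rintro ⟨h2, h3⟩
      exact ⟨h2.symm, (hget h2.symm).symm.trans h3⟩
    · rintro ⟨h2, h3⟩
      exact ⟨h2.symm, (hget h2).trans h3⟩
  have := card_le_maxOrder hc hG hm Finset.univ hX Finset.univ I.toFinset (by simpa using hk) hI
  rw [Finset.card_univ, Finset.card_univ, Fintype.card_fin, Fintype.card_fin,
    ← Set.ncard_eq_toFinset_card', hIcard] at this
  omega

theorem theorem4 (k ℓ m : ℕ) (hk : 1 ≤ k) (hm : 3 ≤ m) (hℓ : ℓ ≤ k) :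
    (∃ n : ℕ, GallaiRamseyProperty k ℓ m (bookGraph m) n) ∧
      (gallaiRamseyNumber k ℓ m (bookGraph m) : ℤ) ≤ gallaiRamseyBound k ℓ m := by
  have h0 := maxOrder_nonneg hm hk hℓ
  have hprop : GallaiRamseyProperty k ℓ m (bookGraph m) ((maxOrder m k ℓ).toNat + 1) :=
    gallaiRamseyProperty_of_maxOrder_lt hk hm (by push_cast; omega)
  refine ⟨⟨_, hprop⟩, ?_⟩
  have h1 : gallaiRamseyNumber k ℓ m (bookGraph m) ≤ (maxOrder m k ℓ).toNat + 1 :=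
    Nat.sInf_le hprop
  have h2 : gallaiRamseyBound k ℓ m = maxOrder m k ℓ + 1 := by rw [maxOrder]; ring
  omega
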